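/- Let $K$ be a field of characteristic $0$, complete with respect to a nontrivial nonarchimedean absolute value. By a manifold we mean a paracompact Hausdorff finite-dimensional locally $K$-analytic manifold (in a fixed universe); $\mathbf{La}$ is the category of manifolds and locally analytic maps, with the Grothendieck topology generated by open coverings. Let $G$ be a locally $K$-analytic Lie group, $y(G)$ the sheaf of groups on $\mathbf{La}$ it represents, and $BG$ the topos of sheaves on $\mathbf{La}$ with an action of $y(G)$. Abelian group objects of $BG$ are sheaves of abelian groups on $\mathbf{La}$ with an additive action of $y(G)$; for such an $\mathcal A$ put $H^i(G,\mathcal A):=(R^i\Gamma)(\mathcal A)$, where $\Gamma(\mathcal A)=\operatorname{Hom}_{BG}(*,\mathcal A)$. Let $V$ be a Hausdorff locally convex $K$-vector space. A function $f$ from a manifold $X$ to $V$ is called analytic if every point of $X$ has an open neighbourhood $U$ such that $f|_U$ factors through an analytic map $U\to W$ to a $K$-Banach space $W$ with a continuous linear injection $W\hookrightarrow V$. Let $G$ act on $V$ by continuous linear automorphisms such that all orbit maps $G\to V$, $g\mapsto gv$, are analytic (a locally analytic representation). Let $\underline V$ be the sheaf whose sections over $X$ are the admissible functions, i.e. the analytic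 functions $f\colon X\to V$ such that $G\times X\to V$, $(g,x)\mapsto g f(x)$, is analytic; $y(G)$ acts on $\underline V$ by $(\rho f)(x)=\rho(x)f(x)$, so that $\underline V$ is an abelian group object of $BG$. Put $H^i_{\mathrm{an}}(G,V):=H^i(G,\underline V)$; the scalars $c\in K$ act on it through multiplication by $c$ on $\underline V$. Let $C^{\mathrm{an}}_G(E_\bullet G,V)$ be the complex which in degree $p\ge 0$ consists of the analytic functions $f\colon G^{p+1}\to V$ with $f(gg_0,\dots,gg_p)=g f(g_0,\dots,g_p)$ for all $g,g_0,\dots,g_p\in G$, with differential $(df)(g_0,\dots,g_{p+1})=\sum_{j=0}^{p+1}(-1)^j f(g_0,\dots,\widehat{g_j},\dots,g_{p+1})$. Then for every $i\ge 0$ there is a $K$-linear isomorphism \[ H^i_{\mathrm{an}}(G,V)\;\cong\;H^i\bigl(C^{\mathrm{an}}_G(E_\bullet G,V)\bigr). \] -/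

import Mathlib

open CategoryTheory Opposite

universe v' u' v u

namespace LocAnCoh

section EquivariantSheaves

theorem enoughInjectives_sheaf {C : Type u} [Category.{v} C] (J : GrothendieckTopology C) :
    EnoughInjectives (Sheaf J AddCommGrpCat.{max u v}) := by
  have : EssentiallySmall.{max u v} C := inferInstance
  have := Sheaf.isGrothendieckAbelian_of_essentiallySmall.{max u v} J AddCommGrpCat.{max u v}
  infer_instance

variable {C : Type u} [Category.{v} C]

/-- A sheaf `F` on the site `(C, J)` with values in `D`, together with an action of the presheaf of
groups `𝒢`: for every `X` the group `𝒢(X)` acts on `F(X)` from the left, compatibly with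
restriction. For `D` the category of types this is an object of the classifying topos `B𝒢`; for
`D` the category of abelian groups it is an abelian group object of `B𝒢`. -/
structure EquivariantSheaf (J : GrothendieckTopology C) (𝒢 : Cᵒᵖ ⥤ GrpCat.{v})
    (D : Type u') [Category.{v'} D] where
  sheaf : Sheaf J D
  act (X : Cᵒᵖ) : 𝒢.obj X →* End (sheaf.obj.obj X)
  act_map {X Y : Cᵒᵖ} (f : X ⟶ Y) (g : 𝒢.obj X) :
    (act X g : sheaf.obj.obj X ⟶ sheaf.obj.obj X) ≫ sheaf.obj.map f =
      sheaf.obj.map f ≫ act Y (𝒢.map f g)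

namespace EquivariantSheaf

variable {J : GrothendieckTopology C} {𝒢 : Cᵒᵖ ⥤ GrpCat.{v}} {D : Type u'} [Category.{v'} D]

/-- Morphisms of sheaves with `𝒢`-action: the equivariant morphisms of sheaves. -/
@[ext]
structure Hom (A B : EquivariantSheaf J 𝒢 D) where
  hom : A.sheaf ⟶ B.sheaf
  comm (X : Cᵒᵖ) (g : 𝒢.obj X) :
    (A.act X g : A.sheaf.obj.obj X ⟶ A.sheaf.obj.obj X) ≫ hom.hom.app X =
      hom.hom.app X ≫ B.act X g

instance : Category (EquivariantSheaf J 𝒢 D) where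
  Hom := Hom
  id A := ⟨𝟙 _, by intros; simp⟩
  comp f g := ⟨f.hom ≫ g.hom, fun X x => by
    have h1 := f.comm X x
    have h2 := g.comm X x
    simp only [ObjectProperty.FullSubcategory.comp_hom, NatTrans.comp_app, Category.assoc]
    rw [← h2, reassoc_of% h1]⟩

@[ext]
theorem hom_ext {A B : EquivariantSheaf J 𝒢 D} {f g : A ⟶ B} (h : f.hom = g.hom) : f = g :=
  Hom.ext h

@[simp] theorem id_hom (A : EquivariantSheaf J 𝒢 D) : Hom.hom (𝟙 A) = 𝟙 A.sheaf := rfl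

@[simp] theorem comp_hom {A B E : EquivariantSheaf J 𝒢 D} (f : A ⟶ B) (g : B ⟶ E) :
    (f ≫ g).hom = f.hom ≫ g.hom := rfl

section Preadditive

variable [Preadditive D] (A B : EquivariantSheaf J 𝒢 D)

instance : Zero (A ⟶ B) := ⟨⟨0, by intros; simp⟩⟩
instance : Add (A ⟶ B) := ⟨fun f g => ⟨f.hom + g.hom, fun X x =>
  (Preadditive.comp_add _ _ _ _ (f.hom.hom.app X) (g.hom.hom.app X)).trans <|
    (congrArg₂ (· + ·) (f.comm X x) (g.comm X x)).trans
      (Preadditive.add_comp _ _ _ _ _ _).symm⟩⟩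
instance : Neg (A ⟶ B) := ⟨fun f => ⟨-f.hom, fun X x =>
  (Preadditive.comp_neg _ (f.hom.hom.app X)).trans <|
    (congrArg (- ·) (f.comm X x)).trans (Preadditive.neg_comp _ _).symm⟩⟩
instance : Sub (A ⟶ B) := ⟨fun f g => ⟨f.hom - g.hom, fun X x =>
  (Preadditive.comp_sub _ (f.hom.hom.app X) (g.hom.hom.app X)).trans <|
    (congrArg₂ (· - ·) (f.comm X x) (g.comm X x)).trans (Preadditive.sub_comp _ _ _).symm⟩⟩
instance : SMul ℕ (A ⟶ B) := ⟨fun n f => ⟨n • f.hom, fun X x =>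
  (Preadditive.comp_nsmul _ (f.hom.hom.app X) n).trans <|
    (congrArg (n • ·) (f.comm X x)).trans (Preadditive.nsmul_comp _ _ _).symm⟩⟩
instance : SMul ℤ (A ⟶ B) := ⟨fun n f => ⟨n • f.hom, fun X x =>
  (Preadditive.comp_zsmul _ (f.hom.hom.app X) n).trans <|
    (congrArg (n • ·) (f.comm X x)).trans (Preadditive.zsmul_comp _ _ _).symm⟩⟩

instance : AddCommGroup (A ⟶ B) :=
  Function.Injective.addCommGroup (fun f : A ⟶ B => f.hom) (fun _ _ h => hom_ext h) rfl
    (fun _ _ => rfl) (fun _ => rfl) (fun _ _ => rfl) (fun _ _ => rfl) (fun _ _ => rfl)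

@[simp] theorem add_hom {A B : EquivariantSheaf J 𝒢 D} (f g : A ⟶ B) :
    (f + g).hom = f.hom + g.hom := rfl

instance : Preadditive (EquivariantSheaf J 𝒢 D) where
  add_comp _ _ _ f g h := by ext1; simp [Preadditive.add_comp]
  comp_add _ _ _ f g h := by ext1; simp [Preadditive.comp_add]

end Preadditive

end EquivariantSheaf

/-! The category of sheaves with `𝒢`-action is equivalent to a category of sheaves on a site: the
site has the same objects as `C`, but morphisms are twisted by sections of `𝒢`. This is only used
to see that abelian sheaves with `𝒢`-action form an abelian category with enough injectives. -/

structure Twist (𝒢 : Cᵒᵖ ⥤ GrpCat.{v}) where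
  base : C

namespace Twist

variable {𝒢 : Cᵒᵖ ⥤ GrpCat.{v}}

@[ext]
structure Hom (X Y : Twist 𝒢) where
  base : X.base ⟶ Y.base
  tw : 𝒢.obj (op X.base)

instance : Category (Twist 𝒢) where
  Hom := Hom
  id X := ⟨𝟙 _, 1⟩
  comp f g := ⟨f.base ≫ g.base, f.tw * 𝒢.map f.base.op g.tw⟩
  id_comp f := by apply Hom.ext <;> simp
  comp_id f := by apply Hom.ext <;> simp
  assoc f g h := by apply Hom.ext <;> simp [mul_assoc]

def homMk {X Y : Twist 𝒢} (f : X.base ⟶ Y.base) (g : 𝒢.obj (op X.base)) : X ⟶ Y := ⟨f, g⟩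

@[simp] theorem homMk_base {X Y : Twist 𝒢} (f : X.base ⟶ Y.base) (g : 𝒢.obj (op X.base)) :
    (homMk f g : X ⟶ Y).base = f := rfl
@[simp] theorem homMk_tw {X Y : Twist 𝒢} (f : X.base ⟶ Y.base) (g : 𝒢.obj (op X.base)) :
    (homMk f g : X ⟶ Y).tw = g := rfl

@[ext]
theorem hom_ext {X Y : Twist 𝒢} {f g : X ⟶ Y} (h : f.base = g.base) (h' : f.tw = g.tw) : f = g :=
  Hom.ext h h'

@[simp] theorem id_base (X : Twist 𝒢) : Hom.base (𝟙 X) = 𝟙 X.base := rfl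
@[simp] theorem id_tw (X : Twist 𝒢) : Hom.tw (𝟙 X) = 1 := rfl
@[simp] theorem comp_base {X Y Z : Twist 𝒢} (f : X ⟶ Y) (g : Y ⟶ Z) :
    (f ≫ g).base = f.base ≫ g.base := rfl
@[simp] theorem comp_tw {X Y Z : Twist 𝒢} (f : X ⟶ Y) (g : Y ⟶ Z) :
    (f ≫ g).tw = f.tw * 𝒢.map f.base.op g.tw := rfl

variable (𝒢) in
def incl : C ⥤ Twist 𝒢 where
  obj X := ⟨X⟩
  map f := homMk f 1
  map_id X := rfl
  map_comp f g := by ext <;> simp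

/-- Sieves do not see the twists. -/
theorem mem_of_base_eq {X Y : Twist 𝒢} {S : Sieve X} {f f' : Y ⟶ X} (h : f.base = f'.base)
    (hf : S f) : S f' := by
  have : f' = (Twist.homMk (𝟙 _) (f'.tw * f.tw⁻¹) : Y ⟶ Y) ≫ f := by
    ext <;> simp [h]
  rw [this]
  exact S.downward_closed hf _

variable (𝒢) in
/-- A sieve is covering if its untwisted part is covering. -/
def topology (J : GrothendieckTopology C) : GrothendieckTopology (Twist 𝒢) where
  sieves X := { S | Sieve.functorPullback (incl 𝒢) (X := X.base) S ∈ J X.base }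
  top_mem' X := J.top_mem X.base
  pullback_stable' X Y S f hS := by
    refine J.superset_covering ?_ (J.pullback_stable f.base hS)
    intro Z g hg
    exact mem_of_base_eq (S := S) (f := (incl 𝒢).map (g ≫ f.base)) rfl hg
  transitive' X S hS R hR := by
    refine J.transitive hS _ fun Y f hf => ?_
    refine J.superset_covering ?_ (hR (Y := ⟨Y⟩) (f := (incl 𝒢).map f) hf)
    intro Z g hg
    exact mem_of_base_eq (S := R) (f := (incl 𝒢).map g ≫ ((incl 𝒢).map f : _ ⟶ X)) rfl hg

end Twist

namespace EquivariantSheaf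

variable {J : GrothendieckTopology C} {𝒢 : Cᵒᵖ ⥤ GrpCat.{v}} {D : Type u'} [Category.{v'} D]

def toPresheaf (A : EquivariantSheaf J 𝒢 D) : (Twist 𝒢)ᵒᵖ ⥤ D where
  obj X := A.sheaf.obj.obj (op X.unop.base)
  map f := A.sheaf.obj.map f.unop.base.op ≫ A.act _ f.unop.tw
  map_id X := by simp [End.one_def]
  map_comp f g := by
    have := A.act_map g.unop.base.op f.unop.tw
    simp [End.mul_def, reassoc_of% this]

theorem toPresheaf_map_incl (A : EquivariantSheaf J 𝒢 D) {X Y : C} (f : X ⟶ Y) :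
    A.toPresheaf.map ((Twist.incl 𝒢).map f).op = A.sheaf.obj.map f.op := by
  simp [toPresheaf, Twist.incl, End.one_def]

/-- The presheaf `A.toPresheaf` is a sheaf. -/
theorem toPresheaf_isSheaf (A : EquivariantSheaf J 𝒢 D) :
    Presheaf.IsSheaf (Twist.topology 𝒢 J) A.toPresheaf := by
  intro E X S hS x hx
  have key := A.sheaf.property E _ hS
  have hx' : ∀ {Y₁ Y₂ Z : Twist 𝒢} (g₁ : Z ⟶ Y₁) (g₂ : Z ⟶ Y₂) {f₁ : Y₁ ⟶ X} {f₂ : Y₂ ⟶ X}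
      (h₁ : S f₁) (h₂ : S f₂), g₁ ≫ f₁ = g₂ ≫ f₂ →
      (x f₁ h₁ : E ⟶ A.toPresheaf.obj (op Y₁)) ≫ A.toPresheaf.map g₁.op =
      (x f₂ h₂ : E ⟶ A.toPresheaf.obj (op Y₂)) ≫ A.toPresheaf.map g₂.op :=
    fun g₁ g₂ _ _ h₁ h₂ h => hx g₁ g₂ h₁ h₂ h
  let y : Presieve.FamilyOfElements (A.sheaf.obj ⋙ coyoneda.obj (op E))
      (Sieve.functorPullback (Twist.incl 𝒢) (X := X.base) S).arrows :=
    fun Y f hf => x (Y := ⟨Y⟩) ((Twist.incl 𝒢).map f) hf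
  have hy : y.Compatible := by
    intro Y₁ Y₂ Z g₁ g₂ f₁ f₂ h₁ h₂ h
    have := hx' (Z := ⟨Z⟩) ((Twist.incl 𝒢).map g₁) ((Twist.incl 𝒢).map g₂) h₁ h₂ (by
      apply Twist.hom_ext
      · exact h
      · simp [Twist.incl])
    erw [toPresheaf_map_incl, toPresheaf_map_incl] at this
    exact this
  obtain ⟨t, ht, ht'⟩ := key y hy
  refine ⟨t, fun Y f hf => ?_, fun t' h' => ht' t' fun Y f hf => ?_⟩
  · have hf' : S (Y := ⟨Y.base⟩) ((Twist.incl 𝒢).map f.base) :=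
      Twist.mem_of_base_eq (S := S) (f := f) rfl hf
    have h1 : (t : E ⟶ A.sheaf.obj.obj (op X.base)) ≫ A.sheaf.obj.map f.base.op =
        x (Y := ⟨Y.base⟩) ((Twist.incl 𝒢).map f.base) hf' :=
      ht f.base hf'
    have h2 := hx' (Z := Y) (Y₁ := Y) (Twist.homMk (𝟙 _) (f.tw) : Y ⟶ Y) (𝟙 _)
      (f₁ := (Twist.incl 𝒢).map f.base) (f₂ := f)
      hf' hf (by
        apply Twist.hom_ext
        · rfl
        · simp [Twist.incl])
    rw [op_id, A.toPresheaf.map_id, Category.comp_id] at h2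
    have h3 : (t : E ⟶ A.toPresheaf.obj (op X)) ≫ A.toPresheaf.map f.op = x f hf := by
      rw [← h2]
      erw [← h1]
      simp [toPresheaf]
    exact h3
  · have h1 : (t' : E ⟶ A.toPresheaf.obj (op X)) ≫
        A.toPresheaf.map (Quiver.Hom.op (X := ⟨Y⟩) ((Twist.incl 𝒢).map f)) =
        x (Y := ⟨Y⟩) ((Twist.incl 𝒢).map f) hf := h' _ hf
    erw [toPresheaf_map_incl] at h1
    exact h1

variable (J 𝒢 D) in
def toSheafTwist : EquivariantSheaf J 𝒢 D ⥤ Sheaf (Twist.topology 𝒢 J) D where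
  obj A := ⟨A.toPresheaf, A.toPresheaf_isSheaf⟩
  map {A B} f := ⟨{
    app X := f.hom.hom.app (op X.unop.base)
    naturality X Y g := by
      have := f.comm (op Y.unop.base) g.unop.tw
      simp [toPresheaf, this] }⟩

instance : (toSheafTwist J 𝒢 D).Faithful where
  map_injective {A B} f g h := by
    ext X
    have := congrArg (fun (k : (toSheafTwist J 𝒢 D).obj A ⟶ (toSheafTwist J 𝒢 D).obj B) =>
      k.hom.app (op ⟨X.unop⟩)) h
    exact this

instance : (toSheafTwist J 𝒢 D).Full where
  map_surjective {A B} f := by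
    refine ⟨⟨⟨{ app X := f.hom.app (op ⟨X.unop⟩), naturality X Y g := ?_ }⟩, fun X g => ?_⟩, ?_⟩
    · have := f.hom.naturality (X := op ⟨X.unop⟩) (Y := op ⟨Y.unop⟩) ((Twist.incl 𝒢).map g.unop).op
      erw [toPresheaf_map_incl, toPresheaf_map_incl] at this
      exact this
    · have := f.hom.naturality (X := op ⟨X.unop⟩) (Y := op ⟨X.unop⟩)
        (Quiver.Hom.op (Twist.homMk (𝟙 _) (g) : (⟨X.unop⟩ : Twist 𝒢) ⟶ ⟨X.unop⟩))
      simpa [toSheafTwist, toPresheaf] using this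
    · rfl

theorem isSheaf_incl_comp (F : Sheaf (Twist.topology 𝒢 J) D) :
    Presheaf.IsSheaf J ((Twist.incl 𝒢).op ⋙ F.obj) := by
  intro E X S hS x hx
  have hx' : ∀ {Y₁ Y₂ Z : C} (g₁ : Z ⟶ Y₁) (g₂ : Z ⟶ Y₂) {f₁ : Y₁ ⟶ X} {f₂ : Y₂ ⟶ X}
      (h₁ : S f₁) (h₂ : S f₂), g₁ ≫ f₁ = g₂ ≫ f₂ →
      (x f₁ h₁ : E ⟶ F.obj.obj (op ⟨Y₁⟩)) ≫ F.obj.map ((Twist.incl 𝒢).map g₁).op =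
      (x f₂ h₂ : E ⟶ F.obj.obj (op ⟨Y₂⟩)) ≫ F.obj.map ((Twist.incl 𝒢).map g₂).op :=
    fun g₁ g₂ _ _ h₁ h₂ h => hx g₁ g₂ h₁ h₂ h
  let S' : Sieve (⟨X⟩ : Twist 𝒢) :=
    { arrows := fun Y f => S f.base
      downward_closed := fun {Y Z f} hf g => S.downward_closed hf g.base }
  have hS' : S' ∈ Twist.topology 𝒢 J ⟨X⟩ := by
    refine J.superset_covering ?_ hS
    intro Y f hf
    exact hf
  let x' : Presieve.FamilyOfElements (F.obj ⋙ coyoneda.obj (op E)) S'.arrows := fun Y f hf =>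
    (x f.base hf : E ⟶ F.obj.obj (op Y)) ≫
      F.obj.map (Quiver.Hom.op (Twist.homMk (𝟙 _) (f.tw) : Y ⟶ Y))
  have tr : ∀ {Y Z : Twist 𝒢} (g : Z ⟶ Y) (f : Y ⟶ ⟨X⟩) (hf : S f.base),
      ((x f.base hf : E ⟶ F.obj.obj (op Y)) ≫
        F.obj.map (Quiver.Hom.op (Twist.homMk (𝟙 _) (f.tw) : Y ⟶ Y))) ≫ F.obj.map g.op =
      ((x f.base hf : E ⟶ F.obj.obj (op Y)) ≫
        F.obj.map (Quiver.Hom.op (Twist.homMk (g.base) (1) : Z ⟶ Y))) ≫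
        F.obj.map (Quiver.Hom.op (Twist.homMk (𝟙 _) ((g ≫ f).tw) : Z ⟶ Z)) := by
    intro Y Z g f hf
    have e : g ≫ (Twist.homMk (𝟙 _) f.tw : Y ⟶ Y) =
        (Twist.homMk (𝟙 _) (g ≫ f).tw : Z ⟶ Z) ≫ (Twist.homMk g.base 1 : Z ⟶ Y) := by
      ext <;> simp
    refine (Category.assoc _ _ _).trans (Eq.trans ?_ (Category.assoc _ _ _).symm)
    refine congrArg ((x f.base hf : E ⟶ F.obj.obj (op Y)) ≫ ·) ?_
    refine (F.obj.map_comp _ _).symm.trans (Eq.trans ?_ (F.obj.map_comp _ _))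
    exact congrArg (fun k => F.obj.map (Quiver.Hom.op k)) e
  have hxc : x'.Compatible := by
    intro Y₁ Y₂ Z g₁ g₂ f₁ f₂ h₁ h₂ h
    have e := hx' g₁.base g₂.base h₁ h₂ (congrArg Twist.Hom.base h)
    refine (tr g₁ f₁ h₁).trans (Eq.trans ?_ (tr g₂ f₂ h₂).symm)
    rw [h]
    exact congrArg (· ≫ F.obj.map (Quiver.Hom.op (Twist.homMk (𝟙 _) ((g₂ ≫ f₂).tw) : Z ⟶ Z))) e
  obtain ⟨t, ht, ht'⟩ := F.property E S' hS' x' hxc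
  refine ⟨t, fun Y f hf => ?_, fun t' h' => ht' t' fun Y f hf => ?_⟩
  · refine (ht (Y := ⟨Y⟩) ((Twist.incl 𝒢).map f) hf).trans ?_
    refine Eq.trans ?_ (Category.comp_id (x f hf : E ⟶ F.obj.obj (op ⟨Y⟩)))
    exact congrArg ((x f hf : E ⟶ F.obj.obj (op ⟨Y⟩)) ≫ ·) (F.obj.map_id _)
  · have h1 : (t' : E ⟶ F.obj.obj (op ⟨X⟩)) ≫ F.obj.map ((Twist.incl 𝒢).map f.base).op =
        x f.base hf := h' f.base hf
    have h2 : f = (Twist.homMk (𝟙 _) (f.tw) : Y ⟶ Y) ≫ (Twist.homMk (f.base) (1) : Y ⟶ ⟨X⟩) := by ext <;> simp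
    have h3 : (t' : E ⟶ F.obj.obj (op ⟨X⟩)) ≫ F.obj.map f.op =
        (x f.base hf : E ⟶ F.obj.obj (op Y)) ≫
          F.obj.map (Quiver.Hom.op (Twist.homMk (𝟙 _) (f.tw) : Y ⟶ Y)) := by
      rw [← h1]
      refine Eq.trans ?_ (Category.assoc _ _ _).symm
      refine congrArg ((t' : E ⟶ F.obj.obj (op ⟨X⟩)) ≫ ·) ?_
      refine Eq.trans ?_ (F.obj.map_comp _ _)
      exact congrArg (fun k => F.obj.map (Quiver.Hom.op k)) h2
    exact h3

/-- The equivariant sheaf attached to a sheaf on the twisted site. -/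
def ofSheafTwist (F : Sheaf (Twist.topology 𝒢 J) D) : EquivariantSheaf J 𝒢 D where
  sheaf := ⟨(Twist.incl 𝒢).op ⋙ F.obj, isSheaf_incl_comp F⟩
  act X :=
    { toFun g := F.obj.map (Quiver.Hom.op (Twist.homMk (𝟙 _) (g) : (⟨X.unop⟩ : Twist 𝒢) ⟶ ⟨X.unop⟩))
      map_one' := F.obj.map_id _
      map_mul' g h := by
        refine Eq.trans ?_ (F.obj.map_comp _ _)
        refine congrArg (fun k : (⟨X.unop⟩ : Twist 𝒢) ⟶ ⟨X.unop⟩ => F.obj.map (Quiver.Hom.op k))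
          (a₂ := Twist.homMk (𝟙 _) g ≫ Twist.homMk (𝟙 _) h) ?_
        ext <;> simp }
  act_map {X Y} f g := by
    refine (F.obj.map_comp _ _).symm.trans (Eq.trans ?_ (F.obj.map_comp _ _))
    congr 1
    apply Quiver.Hom.unop_inj
    ext <;> simp [Twist.incl]

instance : (toSheafTwist J 𝒢 D).EssSurj where
  mem_essImage F := by
    refine ⟨ofSheafTwist F, ⟨(fullyFaithfulSheafToPresheaf _ _).preimageIso
      (NatIso.ofComponents (fun X => Iso.refl _) fun {X Y} f => ?_)⟩⟩
    refine (Category.comp_id _).trans (Eq.trans ?_ (Category.id_comp _).symm)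
    refine (F.obj.map_comp _ _).symm.trans ?_
    congr 1
    apply Quiver.Hom.unop_inj
    ext <;> simp [Twist.incl]

instance : (toSheafTwist J 𝒢 D).IsEquivalence where

section Abelian

variable (J 𝒢)

instance : Limits.HasFiniteProducts (EquivariantSheaf J 𝒢 AddCommGrpCat.{max u v}) where
  out _ := Adjunction.hasLimitsOfShape_of_equivalence (toSheafTwist J 𝒢 _)

noncomputable instance : Abelian (EquivariantSheaf J 𝒢 AddCommGrpCat.{max u v}) :=
  abelianOfEquivalence (toSheafTwist J 𝒢 _)

instance : EnoughInjectives (EquivariantSheaf J 𝒢 AddCommGrpCat.{max u v}) := by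
  have := enoughInjectives_sheaf (Twist.topology 𝒢 J)
  exact .of_equivalence (toSheafTwist J 𝒢 AddCommGrpCat.{max u v})

end Abelian

section GlobalSections

/-- The action of a section of `𝒢` as a homomorphism. -/
abbrev actHom (A : EquivariantSheaf J 𝒢 AddCommGrpCat.{max u v}) {X : Cᵒᵖ} (g : 𝒢.obj X) :
    A.sheaf.obj.obj X ⟶ A.sheaf.obj.obj X := A.act X g

/-- The group `Γ(A) = Hom_{B𝒢}(*, A)`. A morphism from the terminal object of `B𝒢` to `A` is a
compatible family of sections `s_X ∈ A(X)` such that each `s_X` is fixed by `𝒢(X)`. -/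
def invariants (A : EquivariantSheaf J 𝒢 AddCommGrpCat.{max u v}) :
    AddSubgroup (∀ X : C, A.sheaf.obj.obj (op X)) where
  carrier := { s | (∀ ⦃X Y : C⦄ (f : X ⟶ Y), A.sheaf.obj.map f.op (s Y) = s X) ∧
    ∀ (X : C) (g : 𝒢.obj (op X)),
      A.actHom g (s X) = s X }
  zero_mem' := by simp
  add_mem' {s t} hs ht := by
    refine ⟨fun X Y f => ?_, fun X g => ?_⟩
    · rw [Pi.add_apply, map_add, hs.1 f, ht.1 f, Pi.add_apply]
    · rw [Pi.add_apply, map_add, hs.2 X g, ht.2 X g]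
  neg_mem' {s} hs := by
    refine ⟨fun X Y f => ?_, fun X g => ?_⟩
    · rw [Pi.neg_apply, map_neg, hs.1 f, Pi.neg_apply]
    · rw [Pi.neg_apply, map_neg, hs.2 X g]

variable (J 𝒢) in
/-- The global section functor `Γ` on abelian group objects of `B𝒢`. -/
def globalSections : EquivariantSheaf J 𝒢 AddCommGrpCat.{max u v} ⥤ AddCommGrpCat.{max u v} where
  obj A := AddCommGrpCat.of A.invariants
  map {A B} f := AddCommGrpCat.ofHom
    { toFun s := ⟨fun X => f.hom.hom.app (op X) (s.1 X), by
        refine ⟨fun X Y h => ?_, fun X g => ?_⟩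
        · refine Eq.trans ?_ (congrArg (f.hom.hom.app (op X)) (s.2.1 h))
          exact (ConcreteCategory.congr_hom (f.hom.hom.naturality h.op) (s.1 Y)).symm
        · refine Eq.trans ?_ (congrArg (f.hom.hom.app (op X)) (s.2.2 X g))
          exact (ConcreteCategory.congr_hom (f.comm (op X) g) (s.1 X)).symm⟩
      map_zero' := by ext X; simp
      map_add' s t := by ext X; simp }

instance : (globalSections J 𝒢).Additive where
  map_add {A B f g} := by
    ext s
    rfl

/-- `Hⁱ(𝒢, A) = (RⁱΓ)(A)`, as a functor of `A`. -/
noncomputable def cohomology (J : GrothendieckTopology C) (𝒢 : Cᵒᵖ ⥤ GrpCat.{v}) (i : ℕ) :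
    EquivariantSheaf J 𝒢 AddCommGrpCat.{max u v} ⥤ AddCommGrpCat.{max u v} :=
  (globalSections J 𝒢).rightDerived i

end GlobalSections

end EquivariantSheaf
end EquivariantSheaves

end LocAnCoh

open scoped Manifold ContDiff

namespace LocAnCoh

section Analytic

variable (K : Type u) [NontriviallyNormedField K]

/-- A BH-space for `V`: a (nonarchimedean) Banach space over `K` with a continuous linear
injection into `V`. -/
structure BHSpace (V : Type u) [AddCommGroup V] [Module K V] [TopologicalSpace V] where
  carrier : Type u
  [normedAddCommGroup : NormedAddCommGroup carrier]
  [normedSpace : NormedSpace K carrier]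
  [completeSpace : CompleteSpace carrier]
  [isUltrametricDist : IsUltrametricDist carrier]
  incl : carrier →L[K] V
  injective : Function.Injective incl

attribute [instance] BHSpace.normedAddCommGroup BHSpace.normedSpace BHSpace.completeSpace
  BHSpace.isUltrametricDist

variable {K} {V : Type u} [AddCommGroup V] [Module K V] [TopologicalSpace V]
variable {E H M : Type*} [NormedAddCommGroup E] [NormedSpace K E] [TopologicalSpace H]
  [TopologicalSpace M] [ChartedSpace H M]
variable {E' H' M' : Type*} [NormedAddCommGroup E'] [NormedSpace K E'] [TopologicalSpace H']
  [TopologicalSpace M'] [ChartedSpace H' M']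

/-- A function `f : M → V` on a manifold is analytic at `x` if there are an open neighbourhood `U`
of `x` and a BH-space `W` of `V` such that `f` restricted to `U` factors through an analytic map
from `U` to `W`. -/
def IsAnalyticAt (I : ModelWithCorners K E H) (f : M → V) (x : M) : Prop :=
  ∃ U : Set M, IsOpen U ∧ x ∈ U ∧ ∃ (W : BHSpace K V) (f' : M → W.carrier),
    ContMDiffOn I 𝓘(K, W.carrier) ω f' U ∧ ∀ y ∈ U, f y = W.incl (f' y)

/-- The (locally) analytic functions `f : M → V`. -/
def IsAnalytic (I : ModelWithCorners K E H) (f : M → V) : Prop :=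
  ∀ x : M, IsAnalyticAt I f x

namespace IsAnalytic

variable {I : ModelWithCorners K E H} {I' : ModelWithCorners K E' H'}

theorem analyticAt_of_eqOn {f : M → V} (hf : IsAnalytic I f) {φ : M' → M} {s : Set M'}
    (hs : IsOpen s) (hφ : ContMDiffOn I' I ω φ s) {h : M' → V} (he : ∀ y ∈ s, h y = f (φ y))
    {x : M'} (hx : x ∈ s) : IsAnalyticAt I' h x := by
  obtain ⟨U, hU, hxU, W, f', hf', h⟩ := hf (φ x)
  exact ⟨s ∩ φ ⁻¹' U, hφ.continuousOn.isOpen_inter_preimage hs hU, ⟨hx, hxU⟩, W, f' ∘ φ,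
    hf'.comp (hφ.mono Set.inter_subset_left) (fun _ h => h.2),
    fun y hy => (he y hy.1).trans (h _ hy.2)⟩

theorem comp {f : M → V} (hf : IsAnalytic I f) {φ : M' → M} (hφ : ContMDiff I' I ω φ) :
    IsAnalytic I' (fun x => f (φ x)) := fun x =>
  hf.analyticAt_of_eqOn isOpen_univ hφ.contMDiffOn (fun _ _ => rfl) (Set.mem_univ x)

theorem zero : IsAnalytic I (fun _ : M => (0 : V)) := fun _ =>
  haveI : IsUltrametricDist PUnit.{u + 1} := ⟨fun _ _ _ => by simp⟩
  ⟨Set.univ, isOpen_univ, trivial,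
    { carrier := PUnit, incl := 0, injective := fun _ _ _ => rfl }, fun _ => 0,
    contMDiffOn_const, fun _ _ => rfl⟩

theorem const_smul {f : M → V} (hf : IsAnalytic I f) (c : K) :
    IsAnalytic I (fun x => c • f x) := by
  intro x
  obtain ⟨U, hU, hx, W, f', hf', h⟩ := hf x
  refine ⟨U, hU, hx, W, fun y => c • f' y, ?_, fun y hy => by simp [h y hy]⟩
  exact (c • ContinuousLinearMap.id K W.carrier).contMDiff.comp_contMDiffOn hf'

end IsAnalytic

theorem isUltrametricDist_prod (W₁ W₂ : Type*) [NormedAddCommGroup W₁] [NormedAddCommGroup W₂]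
    [IsUltrametricDist W₁] [IsUltrametricDist W₂] : IsUltrametricDist (W₁ × W₂) := by
  refine ⟨fun x y z => ?_⟩
  simp only [Prod.dist_eq]
  have h1 := dist_triangle_max x.1 y.1 z.1
  have h2 := dist_triangle_max x.2 y.2 z.2
  refine max_le (h1.trans ?_) (h2.trans ?_)
  · exact max_le_max (le_max_left _ _) (le_max_left _ _)
  · exact max_le_max (le_max_right _ _) (le_max_right _ _)

theorem isUltrametricDist_quotient {W : Type*} [NormedAddCommGroup W] [NormedSpace K W]
    [IsUltrametricDist W] (N : Submodule K W) : IsUltrametricDist (W ⧸ N) := by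
  apply IsUltrametricDist.isUltrametricDist_of_forall_norm_add_le_max_norm
  intro x y
  refine le_of_forall_pos_le_add fun ε hε => ?_
  obtain ⟨a, rfl, ha⟩ := Submodule.Quotient.norm_mk_lt x hε
  obtain ⟨b, rfl, hb⟩ := Submodule.Quotient.norm_mk_lt y hε
  calc _ ≤ ‖a + b‖ := Submodule.Quotient.norm_mk_le _ (a + b)
    _ ≤ max ‖a‖ ‖b‖ := IsUltrametricDist.norm_add_le_max a b
    _ ≤ max _ _ := max_le_max ha.le hb.le
    _ = _ := max_add_add_right _ _ _

/-- The sum of two BH-spaces is a BH-space. -/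
theorem BHSpace.exists_sum [IsTopologicalAddGroup V] [T2Space V] (W₁ W₂ : BHSpace K V) :
    ∃ (W : BHSpace K V) (q : W₁.carrier × W₂.carrier →L[K] W.carrier),
      ∀ x, W.incl (q x) = W₁.incl x.1 + W₂.incl x.2 := by
  let s : W₁.carrier × W₂.carrier →L[K] V := W₁.incl.coprod W₂.incl
  have : IsClosed (s.ker : Set (W₁.carrier × W₂.carrier)) := s.isClosed_ker
  have := isUltrametricDist_prod W₁.carrier W₂.carrier
  have := isUltrametricDist_quotient (K := K) s.ker
  refine ⟨{ carrier := (W₁.carrier × W₂.carrier) ⧸ s.ker, incl := s.ker.liftQL s le_rfl,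
            injective := ?_ }, s.ker.mkQL, fun x => ?_⟩
  · have := Submodule.ker_liftQ_eq_bot s.ker s.toLinearMap le_rfl le_rfl
    exact LinearMap.ker_eq_bot.1 this
  · rfl

theorem IsAnalytic.add [IsTopologicalAddGroup V] [T2Space V] {I : ModelWithCorners K E H}
    {f g : M → V} (hf : IsAnalytic I f) (hg : IsAnalytic I g) :
    IsAnalytic I (fun x => f x + g x) := by
  intro x
  obtain ⟨U₁, hU₁, hx₁, W₁, f', hf', h₁⟩ := hf x
  obtain ⟨U₂, hU₂, hx₂, W₂, g', hg', h₂⟩ := hg x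
  obtain ⟨W, q, hq⟩ := BHSpace.exists_sum W₁ W₂
  refine ⟨U₁ ∩ U₂, hU₁.inter hU₂, ⟨hx₁, hx₂⟩, W, fun y => q (f' y, g' y), ?_, fun y hy => ?_⟩
  · exact q.contMDiff.comp_contMDiffOn
      ((hf'.mono Set.inter_subset_left).prodMk_space (hg'.mono Set.inter_subset_right))
  · simp [hq, h₁ y hy.1, h₂ y hy.2]

end Analytic

section La

variable (K : Type u) [NontriviallyNormedField K]

/-- The category of manifolds: paracompact Hausdorff locally `K`-analytic manifolds modelled on a
finite dimensional `K`-vector space, and locally analytic maps. -/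
structure La where
  carrier : Type u
  model : Type u
  [normedAddCommGroup : NormedAddCommGroup model]
  [normedSpace : NormedSpace K model]
  [finiteDimensional : FiniteDimensional K model]
  [topologicalSpace : TopologicalSpace carrier]
  [t2Space : T2Space carrier]
  [paracompactSpace : ParacompactSpace carrier]
  [chartedSpace : ChartedSpace model carrier]
  [isManifold : IsManifold 𝓘(K, model) ω carrier]

namespace La

attribute [instance] normedAddCommGroup normedSpace finiteDimensional topologicalSpace t2Space
  paracompactSpace chartedSpace isManifold

variable {K}

/-- The model with corners of a manifold (there is no boundary). -/
abbrev I (X : La K) : ModelWithCorners K X.model X.model := 𝓘(K, X.model)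

instance : Category (La K) where
  Hom X Y := C^ω⟮X.I, X.carrier; Y.I, Y.carrier⟯
  id X := ContMDiffMap.id
  comp f g := ContMDiffMap.comp g f

/-- The underlying map of a morphism. -/
def fn {X Y : La K} (f : X ⟶ Y) : C^ω⟮X.I, X.carrier; Y.I, Y.carrier⟯ := f

@[simp] theorem fn_id (X : La K) (x : X.carrier) : fn (𝟙 X) x = x := rfl

@[simp] theorem fn_comp {X Y Z : La K} (f : X ⟶ Y) (g : Y ⟶ Z) (x : X.carrier) :
    fn (f ≫ g) x = fn g (fn f x) := rfl

/-- A paracompact open subset as an open submanifold. -/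
noncomputable def openSub (X : La K) (U : TopologicalSpace.Opens X.carrier) [ParacompactSpace U] : La K where
  carrier := U
  model := X.model

/-- The underlying map of the inclusion of an open submanifold. -/
def openVal (X : La K) (U : TopologicalSpace.Opens X.carrier) [ParacompactSpace U] :
    (X.openSub U).carrier → X.carrier := fun x : U => x.1

theorem contMDiff_openVal (X : La K) (U : TopologicalSpace.Opens X.carrier) [ParacompactSpace U] :
    ContMDiff (X.openSub U).I X.I ω (X.openVal U) :=
  contMDiff_subtype_val (I := X.I) (U := U)

/-- The inclusion of an open submanifold. -/
noncomputable def openIncl (X : La K) (U : TopologicalSpace.Opens X.carrier) [ParacompactSpace U] :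
    X.openSub U ⟶ X :=
  ⟨X.openVal U, X.contMDiff_openVal U⟩

/-- Analytic maps into an open submanifold. -/
theorem contMDiffOn_toOpen {E H M : Type*} [NormedAddCommGroup E] [NormedSpace K E]
    [TopologicalSpace H] [TopologicalSpace M] [ChartedSpace H M] {I : ModelWithCorners K E H}
    {X : La K} {U : TopologicalSpace.Opens X.carrier} [ParacompactSpace U]
    {f : M → (X.openSub U).carrier} {s : Set M}
    (h : ContMDiffOn I X.I ω (fun x => X.openVal U (f x)) s) :
    ContMDiffOn I (X.openSub U).I ω f s := fun x hx =>
  (ChartedSpace.liftPropWithinAt_subtypeVal_comp_iff (U := U) (H' := X.model) f s x).1 (h x hx)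

/-- A map between manifolds with values in an open subset, as a map to the open submanifold. -/
noncomputable def toOpen {X Y : La K} {U : TopologicalSpace.Opens X.carrier} [ParacompactSpace U]
    (f : Y ⟶ X) (h : ∀ y, fn f y ∈ U) : Y ⟶ X.openSub U :=
  ⟨fun y => (⟨fn f y, h y⟩ : U), contMDiffOn_univ.1 (contMDiffOn_toOpen (fn f).contMDiff.contMDiffOn)⟩

/-- Every open subset contains a paracompact open neighbourhood of each of its points. -/
theorem exists_paracompact (X : La K) {U : Set X.carrier} (hU : IsOpen U) {x : X.carrier}
    (hx : x ∈ U) :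
    ∃ V : TopologicalSpace.Opens X.carrier, x ∈ V ∧ (V : Set X.carrier) ⊆ U ∧
      ParacompactSpace V := by
  let e := chartAt X.model x
  let V : TopologicalSpace.Opens X.carrier := ⟨e.source ∩ U, e.open_source.inter hU⟩
  refine ⟨V, ⟨mem_chart_source _ x, hx⟩, Set.inter_subset_right, ?_⟩
  have hemb : Topology.IsEmbedding (fun y : V => e y.1) := by
    have h1 := e.isOpenEmbedding_restrict.isEmbedding
    exact h1.comp (Topology.IsEmbedding.inclusion (Set.inter_subset_left))
  have : TopologicalSpace.MetrizableSpace V := hemb.metrizableSpace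
  let _ := TopologicalSpace.metrizableSpaceMetric V
  infer_instance

variable (K) in
/-- The topology of open coverings: a sieve on `X` is covering if `X` is covered by open
submanifolds (objects of `La`) whose inclusions belong to the sieve. -/
def topology : GrothendieckTopology (La K) where
  sieves X := { S | ∀ x : X.carrier, ∃ (U : TopologicalSpace.Opens X.carrier)
    (_ : ParacompactSpace U), x ∈ U ∧ S (X.openIncl U) }
  top_mem' X x := by
    obtain ⟨V, hV, -, hp⟩ := X.exists_paracompact isOpen_univ (Set.mem_univ x)
    exact ⟨V, hp, hV, trivial⟩
  pullback_stable' X Y S f hS y := by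
    obtain ⟨U, hU, hx, h⟩ := hS (fn f y)
    obtain ⟨V, hV, hVU, hp⟩ := Y.exists_paracompact
      (U.isOpen.preimage (fn f).contMDiff.continuous) (x := y) hx
    refine ⟨V, hp, hV, ?_⟩
    exact S.downward_closed h (toOpen (Y.openIncl V ≫ f) fun z : V => hVU z.2)
  transitive' X S hS R hR x := by
    obtain ⟨U, hU, hx, h⟩ := hS x
    obtain ⟨V, hV, hxV, h'⟩ := hR h ⟨x, hx⟩
    let U' : TopologicalSpace.Opens X.carrier :=
      ⟨X.openVal U '' V, U.isOpen.isOpenMap_subtype_val _ V.isOpen⟩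
    obtain ⟨V', hV', hVU, hp⟩ := X.exists_paracompact U'.isOpen (x := x) ⟨⟨x, hx⟩, hxV, rfl⟩
    refine ⟨V', hp, hV', ?_⟩
    have key : ∀ z : V', ∃ hz : z.1 ∈ U, (⟨z.1, hz⟩ : U) ∈ V := by
      rintro ⟨z, hz⟩
      obtain ⟨w, hw, rfl⟩ := hVU hz
      exact ⟨w.2, hw⟩
    exact R.downward_closed h' (toOpen (toOpen (X.openIncl V') fun z : V' => (key z).1)
      fun z : V' => (key z).2)

/-- A map from `X` to an open submanifold `U` which is the identity on `U`. -/
theorem exists_retraction (X : La K) (U : TopologicalSpace.Opens X.carrier) [ParacompactSpace U]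
    (x : U) : ∃ r : X.carrier → (X.openSub U).carrier, ContMDiffOn X.I (X.openSub U).I ω r U ∧
      ∀ y : U, r y.1 = y := by
  classical
  refine ⟨fun y => if h : y ∈ U then (⟨y, h⟩ : U) else x, ?_, fun y => (dif_pos y.2 :)⟩
  refine contMDiffOn_toOpen ((contMDiffOn_id (I := X.I)).congr fun y hy => ?_)
  have : y ∈ U := hy
  simp [this, openVal]

end La
end La

section Representation

variable {K : Type u} [NontriviallyNormedField K]
variable {E G : Type u} [NormedAddCommGroup E] [NormedSpace K E]
  [TopologicalSpace G] [ChartedSpace E G] [Group G]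
variable {V : Type u} [AddCommGroup V] [Module K V] [TopologicalSpace V]

variable (E) in
/-- A topological representation of `G` on `V` is locally analytic if all orbit maps are
analytic. -/
def IsLocallyAnalyticRep (ρ : G →* (V ≃L[K] V)) : Prop :=
  ∀ v : V, IsAnalytic 𝓘(K, E) (fun g : G => ρ g v)

variable [IsTopologicalAddGroup V] [T2Space V]

variable (E) in
/-- The admissible functions `X → V`: analytic functions `f` such that `(g, x) ↦ g f(x)` is
analytic on `G × X`. -/
def admissible (ρ : G →* (V ≃L[K] V)) (X : La K) : Submodule K (X.carrier → V) where
  carrier := { f | IsAnalytic X.I f ∧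
    IsAnalytic (𝓘(K, E).prod X.I) (fun p : G × X.carrier => ρ p.1 (f p.2)) }
  zero_mem' := ⟨.zero, by simpa using .zero⟩
  add_mem' {f f'} hf hf' := ⟨hf.1.add hf'.1, by simpa using hf.2.add hf'.2⟩
  smul_mem' c f hf := ⟨hf.1.const_smul c, by simpa using hf.2.const_smul c⟩

/-- Pullback of admissible functions. -/
def admissibleMap (ρ : G →* (V ≃L[K] V)) {X Y : La K} (φ : X ⟶ Y) :
    admissible E ρ Y →ₗ[K] admissible E ρ X where
  toFun f := ⟨fun x => f.1 (La.fn φ x), f.2.1.comp (La.fn φ).contMDiff,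
    f.2.2.comp (contMDiff_id.prodMap (La.fn φ).contMDiff)⟩
  map_add' _ _ := rfl
  map_smul' _ _ := rfl

variable (E) in
/-- The presheaf of admissible functions. -/
def admissiblePresheaf (ρ : G →* (V ≃L[K] V)) : (La K)ᵒᵖ ⥤ AddCommGrpCat.{u + 1} where
  obj X := AddCommGrpCat.of (ULift.{u + 1} (admissible E ρ X.unop))
  map φ := AddCommGrpCat.ofHom
    { toFun f := ⟨admissibleMap ρ φ.unop f.down⟩
      map_zero' := rfl
      map_add' _ _ := rfl }

theorem admissiblePresheaf_isSheaf (ρ : G →* (V ≃L[K] V)) :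
    Presheaf.IsSheaf (La.topology K) (admissiblePresheaf E ρ) := by
  rw [Presheaf.isSheaf_iff_isSheaf_forget _ _ (forget AddCommGrpCat.{u + 1}),
    isSheaf_iff_isSheaf_of_type]
  intro X S hS x hx
  let x' : ∀ {Y : La K} (f : Y ⟶ X), S f → admissible E ρ Y := fun f hf => (x f hf).down
  have hx' : ∀ {Y₁ Y₂ Z : La K} (g₁ : Z ⟶ Y₁) (g₂ : Z ⟶ Y₂) {f₁ : Y₁ ⟶ X} {f₂ : Y₂ ⟶ X}
      (h₁ : S f₁) (h₂ : S f₂), g₁ ≫ f₁ = g₂ ≫ f₂ → ∀ z : Z.carrier,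
      (x' f₁ h₁).1 (La.fn g₁ z) = (x' f₂ h₂).1 (La.fn g₂ z) := by
    intro Y₁ Y₂ Z g₁ g₂ f₁ f₂ h₁ h₂ h z
    exact congrArg (fun t : ULift.{u + 1} (admissible E ρ Z) => t.down.1 z)
      (hx g₁ g₂ h₁ h₂ h)
  choose U hU hxU hSU using hS
  let F : X.carrier → V := fun p => (x' _ (hSU p)).1 (⟨p, hxU p⟩ : U p)
  have hF : ∀ {Y : La K} (f : Y ⟶ X) (hf : S f) (y : Y.carrier), (x' f hf).1 y = F (La.fn f y) := by
    intro Y f hf y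
    obtain ⟨W, hyW, hWU, hW⟩ := Y.exists_paracompact
      ((U (La.fn f y)).isOpen.preimage (La.fn f).contMDiff.continuous) (x := y) (hxU _)
    exact hx' (Y.openIncl W) (La.toOpen (Y.openIncl W ≫ f) fun z : W => hWU z.2) hf (hSU _) rfl
      (⟨y, hyW⟩ : W)
  have hF' : ∀ (p : X.carrier) (q : U p), F q = (x' _ (hSU p)).1 q := fun p q =>
    (hF _ (hSU p) q).symm
  have hFa : F ∈ admissible E ρ X := by
    refine ⟨fun p => ?_, fun p => ?_⟩
    · obtain ⟨r, hr, hr'⟩ := X.exists_retraction (U p) ⟨p, hxU p⟩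
      refine (x' _ (hSU p)).2.1.analyticAt_of_eqOn (U p).isOpen hr (fun y hy => ?_) (hxU p)
      rw [hr' ⟨y, hy⟩]
      exact hF' p ⟨y, hy⟩
    · obtain ⟨r, hr, hr'⟩ := X.exists_retraction (U p.2) ⟨p.2, hxU p.2⟩
      refine (x' _ (hSU p.2)).2.2.analyticAt_of_eqOn (φ := Prod.map id r)
        (s := Set.univ ×ˢ (U p.2 : Set X.carrier)) (isOpen_univ.prod (U p.2).isOpen)
        (contMDiffOn_id.prodMap hr) (fun y hy => ?_) ⟨trivial, hxU p.2⟩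
      have : r y.2 = (⟨y.2, hy.2⟩ : U p.2) := hr' ⟨y.2, hy.2⟩
      simp only [Prod.map, id, this]
      exact congrArg (ρ y.1) (hF' p.2 ⟨y.2, hy.2⟩)
  refine ⟨⟨⟨F, hFa⟩⟩, fun Y f hf => ?_, fun t ht => ?_⟩
  · apply ULift.down_injective
    apply Subtype.ext
    funext y
    exact (hF f hf y).symm
  · apply ULift.down_injective
    apply Subtype.ext
    funext p
    exact congrArg (fun t : ULift.{u + 1} (admissible E ρ (X.openSub (U p))) =>
      t.down.1 (⟨p, hxU p⟩ : U p)) (ht _ (hSU p))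

variable [LieGroup 𝓘(K, E) ω G]

variable (K E G) in
/-- The sheaf of groups `y(G)` on `La` represented by `G`. -/
def yG : (La K)ᵒᵖ ⥤ GrpCat.{u} where
  obj X := GrpCat.of C^ω⟮X.unop.I, X.unop.carrier; 𝓘(K, E), G⟯
  map φ := GrpCat.ofHom
    { toFun g := g.comp (La.fn φ.unop)
      map_one' := rfl
      map_mul' _ _ := rfl }

/-- The action of an analytic map `g : X → G` on admissible functions, `(g f)(x) = g(x) f(x)`. -/
def admissibleAct (ρ : G →* (V ≃L[K] V)) (X : La K) (g : C^ω⟮X.I, X.carrier; 𝓘(K, E), G⟯) :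
    admissible E ρ X →ₗ[K] admissible E ρ X where
  toFun f := ⟨fun x => ρ (g x) (f.1 x), f.2.2.comp (g.contMDiff.prodMk contMDiff_id), by
    have h : ContMDiff (𝓘(K, E).prod X.I) (𝓘(K, E).prod X.I) ω
        (fun p : G × X.carrier => (p.1 * g p.2, p.2)) :=
      (contMDiff_fst.mul (g.contMDiff.comp contMDiff_snd)).prodMk contMDiff_snd
    refine cast (congrArg _ (funext fun p => ?_)) (f.2.2.comp h)
    rw [map_mul]
    rfl⟩
  map_add' f f' := by ext x; simp
  map_smul' c f := by ext x; simp

variable (E) in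
/-- The sheaf `V̲` of admissible `V`-valued functions with its action of `y(G)`, an abelian group
object of `BG`. -/
def admissibleSheaf (ρ : G →* (V ≃L[K] V)) :
    EquivariantSheaf (La.topology K) (yG K E G) AddCommGrpCat.{u + 1} where
  sheaf := ⟨admissiblePresheaf E ρ, admissiblePresheaf_isSheaf ρ⟩
  act X :=
    { toFun g := AddCommGrpCat.ofHom
        { toFun := fun f : ULift.{u + 1} (admissible E ρ X.unop) =>
            ULift.up (admissibleAct ρ X.unop g f.down)
          map_zero' := congrArg ULift.up (map_zero (admissibleAct ρ X.unop g))
          map_add' f f' := congrArg ULift.up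
            (map_add (admissibleAct ρ X.unop g) f.down f'.down) }
      map_one' := by
        refine AddCommGrpCat.hom_ext (AddMonoidHom.ext fun f => ?_)
        apply ULift.down_injective
        apply Subtype.ext
        funext x
        exact DFunLike.congr_fun (map_one ρ) _
      map_mul' g h := by
        refine AddCommGrpCat.hom_ext (AddMonoidHom.ext fun f => ?_)
        apply ULift.down_injective
        apply Subtype.ext
        funext x
        exact DFunLike.congr_fun (map_mul ρ _ _) _ }
  act_map f g := rfl

variable (E) in
/-- Multiplication by a scalar `c : K` on `V̲`, as an endomorphism in the category of abelian group
objects of `BG`. -/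
def admissibleSheafSMul (ρ : G →* (V ≃L[K] V)) (c : K) :
    admissibleSheaf E ρ ⟶ admissibleSheaf E ρ where
  hom := ⟨{
    app X := AddCommGrpCat.ofHom
      { toFun := fun f : ULift.{u + 1} (admissible E ρ X.unop) => ULift.up (c • f.down)
        map_zero' := congrArg ULift.up (smul_zero c)
        map_add' f f' := congrArg ULift.up (smul_add c f.down f'.down) }
    naturality X Y f := rfl }⟩
  comm X g := by
    ext f
    apply ULift.down_injective
    exact (map_smul (admissibleAct ρ X.unop g) c f.down).symm

variable (E) in
/-- The locally analytic group cohomology `Hⁱ_an(G, V) = Hⁱ(G, V̲)`. -/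
noncomputable def Han (ρ : G →* (V ≃L[K] V)) (i : ℕ) : AddCommGrpCat.{u + 1} :=
  (EquivariantSheaf.cohomology (La.topology K) (yG K E G) i).obj (admissibleSheaf E ρ)

variable (E) in
/-- The action of a scalar on `Hⁱ_an(G, V)`, by functoriality. -/
noncomputable def HanSMul (ρ : G →* (V ≃L[K] V)) (i : ℕ) (c : K) :
    Han E ρ i ⟶ Han E ρ i :=
  (EquivariantSheaf.cohomology (La.topology K) (yG K E G) i).map (admissibleSheafSMul E ρ c)

end Representation

section Cochains

/-- A map into a finite product of manifolds is analytic if its components are. -/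
theorem contMDiff_pi_manifold {K : Type*} [NontriviallyNormedField K] {ι : Type*} [Fintype ι]
    {E H M : Type*} [NormedAddCommGroup E] [NormedSpace K E] [TopologicalSpace H]
    [TopologicalSpace M] [ChartedSpace H M]
    {E' H' M' : ι → Type*} [∀ i, NormedAddCommGroup (E' i)] [∀ i, NormedSpace K (E' i)]
    [∀ i, TopologicalSpace (H' i)] [∀ i, TopologicalSpace (M' i)]
    [∀ i, ChartedSpace (H' i) (M' i)] {I : ModelWithCorners K E H}
    {I' : ∀ i, ModelWithCorners K (E' i) (H' i)} {f : M → ∀ i, M' i} :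
    ContMDiff I (ModelWithCorners.pi I') ω f ↔ ∀ i, ContMDiff I (I' i) ω (fun x => f x i) := by
  have key : ∀ x, ContMDiffAt I (ModelWithCorners.pi I') ω f x ↔
      ∀ i, ContMDiffAt I (I' i) ω (fun x => f x i) x := by
    intro x
    simp only [contMDiffAt_iff, continuousAt_pi, forall_and]
    exact and_congr_right fun _ => contDiffWithinAt_pi
  exact ⟨fun h i x => (key x).1 (h x) i, fun h x => (key x).2 fun i => h i x⟩

variable {K : Type u} [NontriviallyNormedField K]
variable {E G : Type u} [NormedAddCommGroup E] [NormedSpace K E]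
  [TopologicalSpace G] [ChartedSpace E G] [Group G]
variable {V : Type u} [AddCommGroup V] [Module K V] [TopologicalSpace V]
  [IsTopologicalAddGroup V] [T2Space V]

variable (E) in
/-- Equivariant analytic functions `G^{ι} → V`; for `ι = {0, …, p}` these are the homogeneous
analytic `p`-cochains. -/
def cochains (ρ : G →* (V ≃L[K] V)) (ι : Type) [Fintype ι] : Submodule K ((ι → G) → V) where
  carrier := { f | IsAnalytic (ModelWithCorners.pi fun _ : ι => 𝓘(K, E)) f ∧
    ∀ (g : G) (x : ι → G), f (fun i => g * x i) = ρ g (f x) }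
  zero_mem' := ⟨.zero, by simp⟩
  add_mem' {f f'} hf hf' := ⟨hf.1.add hf'.1, fun g x => by simp [hf.2, hf'.2]⟩
  smul_mem' c f hf := ⟨hf.1.const_smul c, fun g x => by simp [hf.2]⟩

/-- The map on cochains induced by `φ : ι → κ`, i.e. by the map `G^κ → G^ι, x ↦ x ∘ φ`. -/
def cochainsMap (ρ : G →* (V ≃L[K] V)) {ι κ : Type} [Fintype ι] [Fintype κ] (φ : ι → κ) :
    cochains E ρ ι →ₗ[K] cochains E ρ κ where
  toFun f := ⟨fun x => f.1 (fun i => x (φ i)),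
    f.2.1.comp (contMDiff_pi_manifold.2 fun i => contMDiff_pi_manifold.1 contMDiff_id (φ i)),
    fun g x => f.2.2 g fun i => x (φ i)⟩
  map_add' _ _ := rfl
  map_smul' _ _ := rfl

variable (E) in
/-- The cosimplicial `K`-vector space `C^an_G(E_•G, V)`. -/
def cosimplicialCochains (ρ : G →* (V ≃L[K] V)) : CosimplicialObject (ModuleCat.{u} K) where
  obj p := ModuleCat.of K (cochains E ρ (Fin (p.len + 1)))
  map φ := ModuleCat.ofHom (cochainsMap ρ φ.toOrderHom)

variable (E) in
/-- The complex of homogeneous analytic cochains: the differential is the alternating sum of the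
coface maps. -/
noncomputable def cochainComplex (ρ : G →* (V ≃L[K] V)) : CochainComplex (ModuleCat.{u} K) ℕ :=
  (AlgebraicTopology.alternatingCofaceMapComplex _).obj (cosimplicialCochains E ρ)

end Cochains

end LocAnCoh

namespace LocAnCoh

/-! ### Derived functors computed by an exact, effaceable functor to complexes -/

section DerivedComparison

open Limits HomologicalComplex

variable {𝒜 : Type*} [Category* 𝒜] [Abelian 𝒜] {ℬ : Type*} [Category* ℬ] [Abelian ℬ]

/-! For an abelian group object `A` of `BG`, let `Cᵖ(A)` be the group of morphisms `G^{p+1} → A` in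
`BG`, i.e. of equivariant natural families of maps from tuples of sections of `y(G)` to sections of
`A`. These groups form a complex, functorial in `A`. The theorem follows from the stronger claim
that this complex computes `Hⁱ(G, A)` for every `A`, naturally in `A`. The claim rests on three
facts.

(1) `H⁰(C(A)) = Γ(A)`: a zero-cocycle takes the same value on all sections of `G`, and equivariance
makes that value invariant (`invariantsToCochain_exact`).

(2) `C(A)` is exact in positive degrees for injective `A`. Indeed `C(A)` is `Hom` from the free
abelian presheaves on `E_•G` to `A`, and `E_•G` is contractible (`exactAt_homogeneousComplex`).

(3) `A ↦ C(A)` is exact (`shortExact_homogeneousComplex`). Left exactness is formal; the geometry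
lies in the surjectivity. An equivariant family can be rebuilt from a section of `A` over the
manifold `G^{p+1}`, so it suffices that epimorphisms are surjective on sections over each manifold
(`La.app_surjective`). They are so locally, and over an ultrametric field every open covering of a
paracompact manifold is refined by a partition into open sets, on which local lifts glue without any
compatibility condition.

By (2) and (3) the groups `Hⁱ(C(A))` form an effaceable δ-functor, which by (1) extends `Γ`; hence
they are its derived functors (`IsEffaceableExact.nonempty_rightDerived_iso`, by dimension
shifting).

Finally, Yoneda on `G^{p+1}` turns `Cᵖ(V̲)` into the equivariant analytic functions on `G^{p+1}`
(`homogeneousCochainsEquiv`). Admissibility costs nothing there, because `g f(x) = f(gx)`. Scalars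
act through endomorphisms of `V̲`, so naturality in `A` yields `K`-linearity. -/

theorem iCycles_comp_toCycles (K : CochainComplex 𝒜 ℕ) (k : ℕ) :
    K.iCycles k ≫ K.toCycles k (k + 1) = 0 := by
  rw [← cancel_mono (K.iCycles (k + 1))]
  simp

theorem toCycles_comp_cyclesMap {K L : CochainComplex 𝒜 ℕ} (φ : K ⟶ L) (k : ℕ) :
    φ.f k ≫ L.toCycles k (k + 1) = K.toCycles k (k + 1) ≫ cyclesMap φ (k + 1) := by
  rw [← cancel_mono (L.iCycles (k + 1))]
  simp

/-- The cokernel of `Kᵏ → Zᵏ⁺¹(K)` is `Hᵏ⁺¹(K)`, which vanishes. -/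
theorem epi_toCycles_of_exactAt {K : CochainComplex 𝒜 ℕ} {k : ℕ} (h : K.ExactAt (k + 1)) :
    Epi (K.toCycles k (k + 1)) := by
  refine Preadditive.epi_of_isZero_cokernel' _ (K.homologyIsCokernel k (k + 1) (by simp)) ?_
  exact (exactAt_iff_isZero_homology _ _).1 h

/-- The sequence `Zᵏ(K) → Kᵏ → Zᵏ⁺¹(K)` of a cochain complex `K`. -/
noncomputable abbrev cyclesSequence (K : CochainComplex 𝒜 ℕ) (k : ℕ) : ShortComplex 𝒜 :=
  ShortComplex.mk (K.iCycles k) (K.toCycles k (k + 1)) (iCycles_comp_toCycles K k)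

/-- The morphism of sequences of cycles induced by a morphism of complexes. -/
noncomputable abbrev cyclesSequenceMap {K L : CochainComplex 𝒜 ℕ} (φ : K ⟶ L) (k : ℕ) :
    cyclesSequence K k ⟶ cyclesSequence L k :=
  ShortComplex.homMk (cyclesMap φ k) (φ.f k) (cyclesMap φ (k + 1)) (by simp)
    (toCycles_comp_cyclesMap φ k)

theorem shortExact_cyclesSequence {K : CochainComplex 𝒜 ℕ} {k : ℕ} (h : K.ExactAt (k + 1)) :
    (cyclesSequence K k).ShortExact := by
  have h1 : Mono (cyclesSequence K k).f := inferInstanceAs (Mono (K.iCycles k))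
  have h2 : Epi (cyclesSequence K k).g := epi_toCycles_of_exactAt h
  refine ⟨ShortComplex.exact_of_f_is_kernel _ ?_⟩
  refine KernelFork.IsLimit.ofι' _ _ fun {A} (g : A ⟶ K.X k) hg => ?_
  refine ⟨K.liftCycles g (k + 1) (by simp) ?_, K.liftCycles_i _ _ _ _⟩
  have : g ≫ K.toCycles k (k + 1) = 0 := hg
  rw [← K.toCycles_i k (k + 1), ← Category.assoc, this, zero_comp]

theorem exact_comp_isIso {A B C D : ℬ} {f : A ⟶ B} {g : B ⟶ C} (w : f ≫ g = 0)
    (h : (ShortComplex.mk f g w).Exact) (i : C ⟶ D) [IsIso i] (w' : f ≫ g ≫ i = 0) :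
    (ShortComplex.mk f (g ≫ i) w').Exact := by
  refine ShortComplex.exact_of_iso (S₁ := .mk f g w) (S₂ := .mk f (g ≫ i) w')
    (ShortComplex.isoMk (Iso.refl A) (Iso.refl B) (asIso i) ?_ ?_) h
  · simp
  · simp

/-- Both third terms are cokernels, hence determined by the maps `f` and `f'`. This is the device by
which two cohomology groups with the same presentation are identified. -/
theorem exists_iso_of_exact {A B C A' B' C' : ℬ} {f : A ⟶ B} {g : B ⟶ C} {w : f ≫ g = 0}
    (h : (ShortComplex.mk f g w).Exact) [Epi g] {f' : A' ⟶ B'} {g' : B' ⟶ C'} {w' : f' ≫ g' = 0}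
    (h' : (ShortComplex.mk f' g' w').Exact) [Epi g'] (a : A ≅ A') (b : B ≅ B')
    (hab : f ≫ b.hom = a.hom ≫ f') : ∃ c : C ≅ C', g ≫ c.hom = b.hom ≫ g' := by
  have e : Epi (ShortComplex.mk f g w).g := ‹Epi g›
  have e' : Epi (ShortComplex.mk f' g' w').g := ‹Epi g'›
  have hab' : f' ≫ b.inv = a.inv ≫ f := by
    rw [Iso.comp_inv_eq, Category.assoc, hab, Iso.inv_hom_id_assoc]
  have h1 : f ≫ b.hom ≫ g' = 0 := by rw [← Category.assoc, hab, Category.assoc, w', comp_zero]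
  have h2 : f' ≫ b.inv ≫ g = 0 := by rw [← Category.assoc, hab', Category.assoc, w, comp_zero]
  have c1 : g ≫ h.desc (b.hom ≫ g') h1 = b.hom ≫ g' := h.g_desc _ h1
  have c2 : g' ≫ h'.desc (b.inv ≫ g) h2 = b.inv ≫ g := h'.g_desc _ h2
  refine ⟨⟨h.desc (b.hom ≫ g') h1, h'.desc (b.inv ≫ g) h2, ?_, ?_⟩, c1⟩
  · rw [← cancel_epi g, ← Category.assoc, c1, Category.assoc, c2, Iso.hom_inv_id_assoc]
    exact (Category.comp_id g).symm
  · rw [← cancel_epi g', ← Category.assoc, c2, Category.assoc, c1, Iso.inv_hom_id_assoc]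
    exact (Category.comp_id g').symm

/-- A complex of injective objects which is exact in positive degrees. -/
def IsInjectiveCoresolution (K : CochainComplex 𝒜 ℕ) : Prop :=
  (∀ n, Injective (K.X n)) ∧ ∀ n, K.ExactAt (n + 1)

/-- An exact functor to cochain complexes whose cohomology vanishes in positive degrees on
injectives. -/
structure IsEffaceableExact (T : 𝒜 ⥤ CochainComplex ℬ ℕ) [T.PreservesZeroMorphisms] : Prop where
  exact (S : ShortComplex 𝒜) : S.ShortExact → (S.map T).ShortExact
  effaceable (I : 𝒜) [Injective I] (n : ℕ) : (T.obj I).ExactAt (n + 1)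

namespace IsEffaceableExact

variable {T : 𝒜 ⥤ CochainComplex ℬ ℕ} [T.PreservesZeroMorphisms] (hT : IsEffaceableExact T)
  {K L : CochainComplex 𝒜 ℕ} (hK : IsInjectiveCoresolution K) (hL : IsInjectiveCoresolution L)

theorem isZero_homology (hT : IsEffaceableExact T) (I : 𝒜) [Injective I] (n : ℕ) :
    IsZero ((T.obj I).homology (n + 1)) :=
  (exactAt_iff_isZero_homology _ _).1 (hT.effaceable I n)

theorem shortExact_map (hT : IsEffaceableExact T) (hK : IsInjectiveCoresolution K) (k : ℕ) :
    ((cyclesSequence K k).map T).ShortExact :=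
  hT.exact _ (shortExact_cyclesSequence (hK.2 k))

/-- The connecting homomorphism of `Zᵏ(K) → Kᵏ → Zᵏ⁺¹(K)`. -/
noncomputable def connecting (k n : ℕ) : (T.obj (K.cycles (k + 1))).homology n ⟶
    (T.obj (K.cycles k)).homology (n + 1) :=
  (hT.shortExact_map hK k).δ n (n + 1) rfl

theorem connecting_naturality (φ : K ⟶ L) (k n : ℕ) :
    hT.connecting hK k n ≫ homologyMap (T.map (cyclesMap φ k)) (n + 1) =
      homologyMap (T.map (cyclesMap φ (k + 1))) n ≫ hT.connecting hL k n :=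
  HomologySequence.δ_naturality (T.mapShortComplex.map (cyclesSequenceMap φ k))
        (hT.shortExact_map hK k) (hT.shortExact_map hL k) n (n + 1) rfl

theorem comp_connecting (k : ℕ) :
    homologyMap (T.map (K.toCycles k (k + 1))) 0 ≫ hT.connecting hK k 0 = 0 :=
  (hT.shortExact_map hK k).comp_δ 0 1 rfl

theorem exact_connecting (k : ℕ) :
    (ShortComplex.mk _ _ (hT.comp_connecting hK k)).Exact :=
  (hT.shortExact_map hK k).homology_exact₃ 0 1 rfl

/-- The next term of the long exact sequence is `Hⁿ⁺¹(T(Kᵏ))`, zero because `Kᵏ` is injective. -/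
theorem epi_connecting (k n : ℕ) : Epi (hT.connecting hK k n) := by
  have := hK.1 k
  exact (hT.shortExact_map hK k).epi_δ n (n + 1) rfl (hT.isZero_homology (K.X k) n)

/-- In positive degree both neighbouring terms vanish. In degree `0` the term `H⁰(T(Kᵏ))` survives,
and it becomes the source of the relations in `exists_dimensionShift`. -/
theorem isIso_connecting (k n : ℕ) : IsIso (hT.connecting hK k (n + 1)) := by
  have := hK.1 k
  exact (hT.shortExact_map hK k).isIso_δ (n + 1) (n + 2) rfl (hT.isZero_homology (K.X k) n)
    (hT.isZero_homology (K.X k) (n + 1))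

/-- Dimension shifting along an injective coresolution `K`: the connecting homomorphisms
present `Hⁿ⁺¹(T(Zᵏ))` as the cokernel of `H⁰(T(Kᵏ⁺ⁿ)) → H⁰(T(Zᵏ⁺ⁿ⁺¹))`. -/
theorem exists_dimensionShift (hT : IsEffaceableExact T) (n : ℕ) :
    ∀ k j : ℕ, k + n = j → ∃ Δ : ∀ K : CochainComplex 𝒜 ℕ, IsInjectiveCoresolution K →
      ((T.obj (K.cycles (j + 1))).homology 0 ⟶ (T.obj (K.cycles k)).homology (n + 1)),
      (∀ K hK, Epi (Δ K hK) ∧ ∃ w : homologyMap (T.map (K.toCycles j (j + 1))) 0 ≫ Δ K hK = 0,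
        (ShortComplex.mk _ _ w).Exact) ∧
      ∀ (K L : CochainComplex 𝒜 ℕ) (φ : K ⟶ L) (hK : IsInjectiveCoresolution K)
        (hL : IsInjectiveCoresolution L),
        Δ K hK ≫ homologyMap (T.map (cyclesMap φ k)) (n + 1) =
          homologyMap (T.map (cyclesMap φ (j + 1))) 0 ≫ Δ L hL := by
  induction n with
  | zero =>
    rintro k j rfl
    exact ⟨fun K hK => hT.connecting hK k 0, fun K hK => ⟨hT.epi_connecting hK k 0,
      hT.comp_connecting hK k, hT.exact_connecting hK k⟩,
      fun K L φ hK hL => hT.connecting_naturality hK hL φ k 0⟩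
  | succ n ih =>
    rintro k j hj
    -- Passing from `Hⁿ⁺²(T(Zᵏ))` to `Hⁿ⁺¹(T(Zᵏ⁺¹))` raises `k` and lowers the degree by one, so `j`
    -- stays the same. Keeping `j` as a variable with an equation avoids transport between indices.
    obtain ⟨Δ, h1, h2⟩ := ih (k + 1) j (by omega)
    refine ⟨fun K hK => Δ K hK ≫ hT.connecting hK k (n + 1), fun K hK => ⟨?_, ?_, ?_⟩,
      fun K L φ hK hL => ?_⟩
    · have := (h1 K hK).1
      have := hT.epi_connecting hK k (n + 1)
      exact epi_comp _ _
    · obtain ⟨w, -⟩ := (h1 K hK).2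
      rw [← Category.assoc, w, zero_comp]
    · obtain ⟨w, hw⟩ := (h1 K hK).2
      have := hT.isIso_connecting hK k n
      exact exact_comp_isIso w hw (hT.connecting hK k (n + 1)) _
    · change (Δ K hK ≫ hT.connecting hK k (n + 1)) ≫ _ = _ ≫ Δ L hL ≫ hT.connecting hL k (n + 1)
      rw [Category.assoc, hT.connecting_naturality hK hL φ k (n + 1), ← Category.assoc,
        h2 K L φ hK hL, Category.assoc]

end IsEffaceableExact

section CyclesToHomology

variable {M N : CochainComplex ℬ ℕ} {j : ℕ} {Z Z' : ℬ}

/-- The map to homology induced by a map `i` to the cocycles. -/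
noncomputable def toHomology (i : Z ⟶ M.X j) (wi : i ≫ M.d j (j + 1) = 0) : Z ⟶ M.homology j :=
  M.liftCycles i (j + 1) (by simp) wi ≫ M.homologyπ j

theorem toHomology_naturality (φ : M ⟶ N) (i : Z ⟶ M.X j) (wi : i ≫ M.d j (j + 1) = 0)
    (i' : Z' ⟶ N.X j) (wi' : i' ≫ N.d j (j + 1) = 0) (z : Z ⟶ Z') (hz : z ≫ i' = i ≫ φ.f j) :
    toHomology i wi ≫ homologyMap φ j = z ≫ toHomology i' wi' := by
  dsimp only [toHomology]
  rw [Category.assoc, homologyπ_naturality, ← Category.assoc, ← Category.assoc]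
  congr 1
  rw [← cancel_mono (N.iCycles j)]
  simp [hz]

theorem isIso_liftCycles (i : Z ⟶ M.X j) (wi : i ≫ M.d j (j + 1) = 0)
    (hi : IsLimit (KernelFork.ofι i wi)) :
    IsIso (M.liftCycles i (j + 1) (by simp) wi) := by
  have : M.liftCycles i (j + 1) (by simp) wi =
      (hi.conePointUniqueUpToIso (M.cyclesIsKernel j (j + 1) (by simp))).hom := by
    rw [← cancel_mono (M.iCycles j), liftCycles_i]
    exact (hi.conePointUniqueUpToIso_hom_comp (M.cyclesIsKernel j (j + 1) (by simp))
      WalkingParallelPair.zero).symm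
  rw [this]
  infer_instance

theorem epi_toHomology (i : Z ⟶ M.X j) (wi : i ≫ M.d j (j + 1) = 0)
    (hi : IsLimit (KernelFork.ofι i wi)) : Epi (toHomology i wi) := by
  have := isIso_liftCycles i wi hi
  dsimp only [toHomology]
  infer_instance

/-- A kernel `i` identifies `Z` with the cocycles, and then this is the presentation of cohomology
as cocycles modulo coboundaries. It is meant for `Z = F(Zʲ⁺¹(K))`, which is a kernel in `F(K)` when
`F` is left exact. -/
theorem exact_toHomology (i : Z ⟶ M.X (j + 1)) (wi : i ≫ M.d (j + 1) (j + 2) = 0)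
    (hi : IsLimit (KernelFork.ofι i wi)) (t : M.X j ⟶ Z) (ht : t ≫ i = M.d j (j + 1)) :
    ∃ w : t ≫ toHomology i wi = 0, (ShortComplex.mk _ _ w).Exact := by
  have := isIso_liftCycles i wi hi
  have e : t ≫ M.liftCycles i (j + 2) (by simp) wi = M.toCycles j (j + 1) := by
    rw [← cancel_mono (M.iCycles (j + 1))]
    simp [ht]
  have w : t ≫ toHomology i wi = 0 := by
    dsimp only [toHomology]
    rw [← Category.assoc, e, toCycles_comp_homologyπ]
  refine ⟨w, ?_⟩
  let α : ShortComplex.mk _ _ w ⟶ ShortComplex.mk _ _ (M.toCycles_comp_homologyπ j (j + 1)) :=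
    ShortComplex.homMk (𝟙 (M.X j)) (M.liftCycles i (j + 2) (by simp) wi) (𝟙 (M.homology (j + 1)))
      ((Category.id_comp _).trans e.symm) (Category.comp_id _).symm
  have h1 : IsIso α.τ₁ := inferInstanceAs (IsIso (𝟙 (M.X j)))
  have h2 : IsIso α.τ₂ := this
  have h3 : IsIso α.τ₃ := inferInstanceAs (IsIso (𝟙 (M.homology (j + 1))))
  have : IsIso α := ShortComplex.isIso_of_isIso α
  exact ShortComplex.exact_of_iso (asIso α).symm (ShortComplex.exact_of_g_is_cokernel _
    (M.homologyIsCokernel j (j + 1) (by simp)))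

end CyclesToHomology

namespace IsEffaceableExact

variable {T : 𝒜 ⥤ CochainComplex ℬ ℕ} [T.PreservesZeroMorphisms]

/-- `T` is exact and taking degree-zero cocycles is left exact. The result serves twice: for `R⁰F ≅
F`, and to see that `F` of the cocycles of `K` is the kernel in `F(K)`. -/
theorem preservesFiniteLimits (hT : IsEffaceableExact T) {F : 𝒜 ⥤ ℬ} [F.Additive]
    (ε : ∀ A, F.obj A ≅ (T.obj A).cycles 0)
    (hε : ∀ {A B : 𝒜} (f : A ⟶ B), F.map f ≫ (ε B).hom = (ε A).hom ≫ cyclesMap (T.map f) 0) :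
    PreservesFiniteLimits F := by
  refine ((F.preservesFiniteLimits_tfae.out 0 3).1 fun S hS => ?_)
  have hS' := hT.exact S hS
  have : Mono (S.map T).f := hS'.mono_f
  have h1 : Mono (cyclesMap (T.map S.f) 0) := inferInstanceAs (Mono (cyclesMap (S.map T).f 0))
  have h2 := cycles_left_exact (S.map T) hS'.exact 0
  have hε' : ∀ {A B : 𝒜} (f : A ⟶ B), (ε A).inv ≫ F.map f = cyclesMap (T.map f) 0 ≫ (ε B).inv := by
    intro A B f
    rw [Iso.inv_comp_eq, ← Category.assoc, Iso.eq_comp_inv, hε]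
  refine ⟨?_, ?_⟩
  · exact ShortComplex.exact_of_iso (ShortComplex.isoMk (S₁ := .mk (cyclesMap (T.map S.f) 0)
      (cyclesMap (T.map S.g) 0) _) (S₂ := .mk (F.map S.f) (F.map S.g) _) (ε _).symm (ε _).symm
      (ε _).symm (hε' _) (hε' _)) h2
  · have : F.map S.f = (ε _).hom ≫ cyclesMap (T.map S.f) 0 ≫ (ε _).inv := by
      rw [← Category.assoc, Iso.eq_comp_inv, hε]
    rw [this]
    infer_instance

theorem isInjectiveCoresolution {A : 𝒜} (I : InjectiveResolution A) :
    IsInjectiveCoresolution I.cocomplex :=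
  ⟨fun n => I.injective n, fun n => I.cocomplex_exactAt_succ n⟩

/-- The iso of an object with the zeroth cocycles of an injective resolution. -/
noncomputable def augmentationIso {A : 𝒜} (I : InjectiveResolution A) : A ≅ I.cocomplex.cycles 0 :=
  I.isLimitKernelFork.conePointUniqueUpToIso (I.cocomplex.cyclesIsKernel 0 1 (by simp))

theorem augmentationIso_hom_iCycles {A : 𝒜} (I : InjectiveResolution A) :
    (augmentationIso I).hom ≫ I.cocomplex.iCycles 0 = I.ι.f 0 :=
  I.isLimitKernelFork.conePointUniqueUpToIso_hom_comp _ WalkingParallelPair.zero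

theorem augmentationIso_naturality {A B : 𝒜} (f : A ⟶ B) (I : InjectiveResolution A)
    (J : InjectiveResolution B) (φ : I.cocomplex ⟶ J.cocomplex)
    (h : I.ι.f 0 ≫ φ.f 0 = f ≫ J.ι.f 0) :
    f ≫ (augmentationIso J).hom = (augmentationIso I).hom ≫ cyclesMap φ 0 := by
  rw [← cancel_mono (J.cocomplex.iCycles 0), Category.assoc, Category.assoc, cyclesMap_i,
    augmentationIso_hom_iCycles, ← Category.assoc, augmentationIso_hom_iCycles]
  exact h.symm

variable [HasInjectiveResolutions 𝒜]

/-- The derived functors of `H⁰ ∘ T` are the functors `Hⁿ ∘ T`, for `T` exact and effaceable. -/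
theorem nonempty_rightDerived_iso (hT : IsEffaceableExact T) (F : 𝒜 ⥤ ℬ) [F.Additive]
    (ε : ∀ A, F.obj A ≅ (T.obj A).cycles 0)
    (hε : ∀ {A B : 𝒜} (f : A ⟶ B), F.map f ≫ (ε B).hom = (ε A).hom ≫ cyclesMap (T.map f) 0)
    (n : ℕ) : ∃ e : ∀ A, (F.rightDerived n).obj A ≅ (T.obj A).homology n,
      ∀ {A B : 𝒜} (f : A ⟶ B),
        (F.rightDerived n).map f ≫ (e B).hom = (e A).hom ≫ homologyMap (T.map f) n := by
  have := hT.preservesFiniteLimits ε hε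
  let η : ∀ A, F.obj A ≅ (T.obj A).homology 0 := fun A =>
    ε A ≪≫ (T.obj A).isoHomologyπ 0 0 (by simp) (by simp)
  have hη : ∀ {A B : 𝒜} (f : A ⟶ B),
      F.map f ≫ (η B).hom = (η A).hom ≫ homologyMap (T.map f) 0 := by
    intro A B f
    dsimp only [η, Iso.trans_hom]
    rw [← Category.assoc, hε f]
    simp
  cases n with
  | zero =>
    refine ⟨fun A => F.rightDerivedZeroIsoSelf.app A ≪≫ η A, fun {A B} f => ?_⟩
    have h := F.rightDerivedZeroIsoSelf.hom.naturality f
    change (F.rightDerived 0).map f ≫ F.rightDerivedZeroIsoSelf.hom.app B ≫ (η B).hom =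
      (F.rightDerivedZeroIsoSelf.hom.app A ≫ (η A).hom) ≫ homologyMap (T.map f) 0
    rw [← Category.assoc, h, Category.assoc, Category.assoc, hη]
  | succ n =>
    obtain ⟨Δ, h1, h2⟩ := hT.exists_dimensionShift n 0 n (zero_add n)
    let FC := F.mapHomologicalComplex (ComplexShape.up ℕ)
    let incl : ∀ K : CochainComplex 𝒜 ℕ, F.obj (K.cycles (n + 1)) ⟶ (FC.obj K).X (n + 1) :=
      fun K => F.map (K.iCycles (n + 1))
    have wi : ∀ K : CochainComplex 𝒜 ℕ,
        incl K ≫ (FC.obj K).d (n + 1) (n + 2) = 0 := fun K =>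
      (F.map_comp _ _).symm.trans ((congrArg F.map (K.iCycles_d _ _)).trans (F.map_zero _ _))
    have hi : ∀ K : CochainComplex 𝒜 ℕ, IsLimit (KernelFork.ofι (incl K) (wi K)) := fun K =>
      KernelFork.mapIsLimit _ (K.cyclesIsKernel (n + 1) (n + 2) (by simp)) F
    -- Both groups are the cokernel of `F(Kⁿ) → F(Zⁿ⁺¹)`: the left one as cohomology of `F(K)`, the
    -- right one by dimension shifting, once `η` has replaced `F` by `H⁰ ∘ T`.
    have key : ∀ (K : CochainComplex 𝒜 ℕ) (hK : IsInjectiveCoresolution K),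
        ∃ c : (FC.obj K).homology (n + 1) ≅ (T.obj (K.cycles 0)).homology (n + 1),
          toHomology (incl K) (wi K) ≫ c.hom = (η (K.cycles (n + 1))).hom ≫ Δ K hK := by
      intro K hK
      have := (h1 K hK).1
      obtain ⟨w, hw⟩ := (h1 K hK).2
      have := epi_toHomology (j := n + 1) (incl K) (wi K) (hi K)
      obtain ⟨w', hw'⟩ := exact_toHomology (j := n) (incl K) (wi K) (hi K) (F.map (K.toCycles n (n + 1)))
        ((F.map_comp _ _).symm.trans (congrArg F.map (K.toCycles_i _ _)))
      exact exists_iso_of_exact hw' hw (η (K.X n)) (η (K.cycles (n + 1))) (hη _)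
    choose c hc using key
    have hcn : ∀ (K L : CochainComplex 𝒜 ℕ) (hK : IsInjectiveCoresolution K)
        (hL : IsInjectiveCoresolution L) (φ : K ⟶ L),
        homologyMap (FC.map φ) (n + 1) ≫ (c L hL).hom =
          (c K hK).hom ≫ homologyMap (T.map (cyclesMap φ 0)) (n + 1) := by
      intro K L hK hL φ
      have := epi_toHomology (j := n + 1) (incl K) (wi K) (hi K)
      have h := toHomology_naturality (j := n + 1) (FC.map φ) (incl K) (wi K) (incl L) (wi L) (F.map (cyclesMap φ (n + 1)))
        ((F.map_comp _ _).symm.trans ((congrArg F.map (cyclesMap_i _ _)).trans (F.map_comp _ _)))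
      rw [← cancel_epi (toHomology (incl K) (wi K)), ← Category.assoc, h, Category.assoc, hc,
        ← Category.assoc, hη, Category.assoc, ← h2 K L φ hK hL, ← Category.assoc,
        ← Category.assoc, hc]
    let I : ∀ A : 𝒜, InjectiveResolution A := fun A => injectiveResolution A
    let τ : ∀ {A B : 𝒜}, (A ≅ B) → ((T.obj A).homology (n + 1) ≅ (T.obj B).homology (n + 1)) :=
      fun i => (homologyFunctor ℬ _ (n + 1)).mapIso (T.mapIso i)
    -- The chain is `Rⁿ⁺¹F(A) ≅ Hⁿ⁺¹(F(I)) ≅ Hⁿ⁺¹(T(Z⁰(I))) ≅ Hⁿ⁺¹(T(A))`; naturality is then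
    -- checked link by link in `e1`, `e2`, `e3`.
    refine ⟨fun A => (I A).isoRightDerivedObj F (n + 1) ≪≫
      c (I A).cocomplex (isInjectiveCoresolution (I A)) ≪≫ τ (augmentationIso (I A)).symm, ?_⟩
    intro A B f
    let φ : (I A).cocomplex ⟶ (I B).cocomplex := InjectiveResolution.desc f (I B) (I A)
    have hφ : (I A).ι.f 0 ≫ φ.f 0 = f ≫ (I B).ι.f 0 := InjectiveResolution.desc_commutes_zero _ _ _
    have e1 : (F.rightDerived (n + 1)).map f ≫ ((I B).isoRightDerivedObj F (n + 1)).hom =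
        ((I A).isoRightDerivedObj F (n + 1)).hom ≫ homologyMap (FC.map φ) (n + 1) :=
      InjectiveResolution.isoRightDerivedObj_hom_naturality f (I A) (I B) φ hφ F (n + 1)
    have e2 := hcn _ _ (isInjectiveCoresolution (I A)) (isInjectiveCoresolution (I B)) φ
    have e3 : homologyMap (T.map (cyclesMap φ 0)) (n + 1) ≫ (τ (augmentationIso (I B)).symm).hom =
        (τ (augmentationIso (I A)).symm).hom ≫ homologyMap (T.map f) (n + 1) := by
      change homologyMap _ _ ≫ homologyMap (T.map (augmentationIso (I B)).inv) (n + 1) =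
        homologyMap (T.map (augmentationIso (I A)).inv) (n + 1) ≫ _
      rw [← homologyMap_comp, ← homologyMap_comp, ← T.map_comp, ← T.map_comp]
      congr 2
      rw [Iso.eq_inv_comp, ← Category.assoc, ← augmentationIso_naturality f _ _ φ hφ,
        Category.assoc, Iso.hom_inv_id, Category.comp_id]
    change (F.rightDerived (n + 1)).map f ≫ ((I B).isoRightDerivedObj F (n + 1)).hom ≫
      (c _ (isInjectiveCoresolution (I B))).hom ≫ (τ (augmentationIso (I B)).symm).hom =
      (((I A).isoRightDerivedObj F (n + 1)).hom ≫
      (c _ (isInjectiveCoresolution (I A))).hom ≫ (τ (augmentationIso (I A)).symm).hom) ≫ _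
    refine (Category.assoc _ _ _).symm.trans ?_
    refine (eq_whisker e1 _).trans ?_
    refine (Category.assoc _ _ _).trans (Eq.trans ?_ (Category.assoc _ _ _).symm)
    refine whisker_eq _ ?_
    refine (Category.assoc _ _ _).symm.trans ?_
    refine (eq_whisker e2 _).trans ?_
    refine (Category.assoc _ _ _).trans (Eq.trans ?_ (Category.assoc _ _ _).symm)
    exact whisker_eq _ e3

end IsEffaceableExact

end DerivedComparison

/-! ### The complex of homogeneous cochains of an equivariant sheaf -/

section HomogeneousCochains

open Limits HomologicalComplex

variable {C : Type u} [Category.{v} C] {J : GrothendieckTopology C} {𝒢 : Cᵒᵖ ⥤ GrpCat.{v}}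

namespace EquivariantSheaf

/-- Homogeneous cochains with values in an equivariant sheaf `A`: the equivariant natural families
of maps `𝒢(X)^ι → A(X)`, i.e. the morphisms from `𝒢^ι` to `A` in `B𝒢`. -/
def homogeneousCochains (A : EquivariantSheaf J 𝒢 AddCommGrpCat.{max u v}) (ι : Type) :
    AddSubgroup (∀ X : C, (ι → 𝒢.obj (op X)) → A.sheaf.obj.obj (op X)) where
  carrier := { φ | (∀ ⦃X Y : C⦄ (f : X ⟶ Y) (x : ι → 𝒢.obj (op Y)),
      A.sheaf.obj.map f.op (φ Y x) = φ X fun i => 𝒢.map f.op (x i)) ∧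
    ∀ (X : C) (g : 𝒢.obj (op X)) (x : ι → 𝒢.obj (op X)),
      φ X (fun i => g * x i) = A.actHom g (φ X x) }
  zero_mem' := by simp
  add_mem' {φ ψ} hφ hψ := by
    refine ⟨fun X Y f x => ?_, fun X g x => ?_⟩
    · simp only [Pi.add_apply, map_add, hφ.1 f, hψ.1 f]
    · simp only [Pi.add_apply, map_add, hφ.2 X g, hψ.2 X g]
  neg_mem' {φ} hφ := by
    refine ⟨fun X Y f x => ?_, fun X g x => ?_⟩
    · simp only [Pi.neg_apply, map_neg, hφ.1 f]
    · simp only [Pi.neg_apply, map_neg, hφ.2 X g]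

/-- Precomposition of homogeneous cochains with a map of index sets. -/
def homogeneousCochainsPrecomp (A : EquivariantSheaf J 𝒢 AddCommGrpCat.{max u v}) {ι κ : Type}
    (s : ι → κ) : A.homogeneousCochains ι →+ A.homogeneousCochains κ where
  toFun φ := ⟨fun X x => φ.1 X fun i => x (s i), fun _ _ f x => φ.2.1 f fun i => x (s i),
    fun X g x => φ.2.2 X g fun i => x (s i)⟩
  map_zero' := rfl
  map_add' _ _ := rfl

/-- The map on homogeneous cochains induced by a morphism of equivariant sheaves. -/
def homogeneousCochainsMap {A B : EquivariantSheaf J 𝒢 AddCommGrpCat.{max u v}} (f : A ⟶ B)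
    (ι : Type) : A.homogeneousCochains ι →+ B.homogeneousCochains ι where
  toFun φ := ⟨fun X x => f.hom.hom.app (op X) (φ.1 X x), fun X Y h x => by
      refine Eq.trans ?_ (congrArg (f.hom.hom.app (op X)) (φ.2.1 h x))
      exact (ConcreteCategory.congr_hom (f.hom.hom.naturality h.op) (φ.1 Y x)).symm, fun X g x => by
      refine (congrArg (f.hom.hom.app (op X)) (φ.2.2 X g x)).trans ?_
      exact ConcreteCategory.congr_hom (f.comm (op X) g) (φ.1 X x)⟩
  map_zero' := by ext X x; exact map_zero (f.hom.hom.app (op X)).hom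
  map_add' φ ψ := by ext X x; exact map_add (f.hom.hom.app (op X)).hom _ _

/-- The cosimplicial abelian group of homogeneous cochains. -/
def cosimplicialHomogeneousCochains (A : EquivariantSheaf J 𝒢 AddCommGrpCat.{max u v}) :
    CosimplicialObject AddCommGrpCat.{max u v} where
  obj p := AddCommGrpCat.of (A.homogeneousCochains (Fin (p.len + 1)))
  map s := AddCommGrpCat.ofHom (A.homogeneousCochainsPrecomp s.toOrderHom)

/-- The map on cosimplicial homogeneous cochains induced by a morphism of equivariant sheaves. -/
def cosimplicialHomogeneousCochainsMap {A B : EquivariantSheaf J 𝒢 AddCommGrpCat.{max u v}}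
    (f : A ⟶ B) : A.cosimplicialHomogeneousCochains ⟶ B.cosimplicialHomogeneousCochains :=
  NatTrans.mk (fun p => AddCommGrpCat.ofHom (homogeneousCochainsMap f (Fin (p.len + 1))))
    fun _ _ _ => rfl

variable (J 𝒢) in
/-- The complex of homogeneous cochains, as a functor of the equivariant sheaf. -/
def homogeneousComplex :
    EquivariantSheaf J 𝒢 AddCommGrpCat.{max u v} ⥤ CochainComplex AddCommGrpCat.{max u v} ℕ where
  obj A := (AlgebraicTopology.alternatingCofaceMapComplex _).obj A.cosimplicialHomogeneousCochains
  map f := (AlgebraicTopology.alternatingCofaceMapComplex _).map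
    (cosimplicialHomogeneousCochainsMap f)
  map_id _ := ((AlgebraicTopology.alternatingCofaceMapComplex AddCommGrpCat.{max u v}).map_id _ :)
  map_comp f g := ((AlgebraicTopology.alternatingCofaceMapComplex AddCommGrpCat.{max u v}).map_comp
    (cosimplicialHomogeneousCochainsMap f) (cosimplicialHomogeneousCochainsMap g) :)

/-- Cochains of degree `p`, as elements of the complex. -/
def toCochain {A : EquivariantSheaf J 𝒢 AddCommGrpCat.{max u v}} {p : ℕ}
    (φ : A.homogeneousCochains (Fin (p + 1))) : ((homogeneousComplex J 𝒢).obj A).X p := φ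

/-- The underlying family of a cochain of degree `p`. -/
def ofCochain {A : EquivariantSheaf J 𝒢 AddCommGrpCat.{max u v}} {p : ℕ}
    (φ : ((homogeneousComplex J 𝒢).obj A).X p) : A.homogeneousCochains (Fin (p + 1)) := φ

theorem homogeneousComplex_d_apply (A : EquivariantSheaf J 𝒢 AddCommGrpCat.{max u v})
    (p : ℕ) (φ : A.homogeneousCochains (Fin (p + 1))) (X : C)
    (x : Fin (p + 2) → 𝒢.obj (op X)) :
    (ofCochain (((homogeneousComplex J 𝒢).obj A).d p (p + 1) (toCochain φ))).1 X x =
      ∑ j : Fin (p + 2), (-1 : ℤ) ^ (j : ℕ) • φ.1 X fun i => x (j.succAbove i) := by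
  have : ((homogeneousComplex J 𝒢).obj A).d p (p + 1) =
      ∑ i : Fin (p + 2), (-1 : ℤ) ^ (i : ℕ) • A.cosimplicialHomogeneousCochains.δ i :=
    CochainComplex.of_d (fun n => A.cosimplicialHomogeneousCochains.obj (.mk n))
      (AlgebraicTopology.AlternatingCofaceMapComplex.objD _) p
  rw [this]
  let ev : A.homogeneousCochains (Fin (p + 2)) →+ A.sheaf.obj.obj (op X) :=
    { toFun φ := φ.1 X x
      map_zero' := rfl
      map_add' _ _ := rfl }
  -- Evaluation at fixed `φ` and `x` is additive in the differential, so `map_sum` can be applied to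
  -- the alternating sum of cofaces.
  let ev' : (A.cosimplicialHomogeneousCochains.obj (.mk p) ⟶
      A.cosimplicialHomogeneousCochains.obj (.mk (p + 1))) →+ A.sheaf.obj.obj (op X) :=
    { toFun D := ev (D φ)
      map_zero' := rfl
      map_add' _ _ := rfl }
  change ev' _ = _
  rw [map_sum]
  refine Finset.sum_congr rfl fun j _ => ?_
  rw [map_zsmul]
  rfl

instance : (homogeneousComplex J 𝒢).PreservesZeroMorphisms where
  map_zero A B := by
    ext p φ
    rfl

end EquivariantSheaf

end HomogeneousCochains

/-! ### Zero-cocycles are invariants; exactness in the coefficients -/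

section HomogeneousCochains

open Limits HomologicalComplex

variable {C : Type u} [Category.{v} C] {J : GrothendieckTopology C} {𝒢 : Cᵒᵖ ⥤ GrpCat.{v}}

namespace EquivariantSheaf

section ZeroCocycles

variable (A : EquivariantSheaf J 𝒢 AddCommGrpCat.{max u v})

/-- Invariant sections as constant zero-cochains. -/
def invariantsToCochain : (globalSections J 𝒢).obj A ⟶ ((homogeneousComplex J 𝒢).obj A).X 0 :=
  AddCommGrpCat.ofHom
    { toFun := fun s : A.invariants => (toCochain ⟨fun X _ => s.1 X, fun _ _ f _ => s.2.1 f,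
        fun X g _ => (s.2.2 X g).symm⟩ : ((homogeneousComplex J 𝒢).obj A).X 0)
      map_zero' := rfl
      map_add' _ _ := rfl }

theorem invariantsToCochain_d :
    invariantsToCochain A ≫ ((homogeneousComplex J 𝒢).obj A).d 0 1 = 0 := by
  ext (s : A.invariants)
  apply Subtype.ext
  funext X x
  refine (homogeneousComplex_d_apply A 0 ⟨fun X _ => s.1 X, fun _ _ f _ => s.2.1 f,
        fun X g _ => (s.2.2 X g).symm⟩ X x).trans ?_
  simp [Fin.sum_univ_two]
  rfl

instance : Mono (invariantsToCochain A) := by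
  rw [AddCommGrpCat.mono_iff_injective]
  intro s t h
  apply Subtype.ext
  funext X
  exact congrArg (fun φ : A.homogeneousCochains (Fin 1) => φ.1 X 1) h

/-- The cocycle condition at a pair `(x, y)` says `φ(y) = φ(x)`. So `φ` is constant on each `𝒢(X)`,
and its value at the unit section is compatible with restriction and, by equivariance, invariant. -/
theorem invariantsToCochain_exact :
    (ShortComplex.mk _ _ (invariantsToCochain_d A)).Exact := by
  rw [ShortComplex.ab_exact_iff]
  intro (φ : A.homogeneousCochains (Fin 1)) hφ
  have h : ∀ (X : C) (x y : 𝒢.obj (op X)), φ.1 X (fun _ => x) = φ.1 X (fun _ => y) := by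
    intro X x y
    have h1 := homogeneousComplex_d_apply A 0 φ X ![x, y]
    rw [show ofCochain (((homogeneousComplex J 𝒢).obj A).d 0 1 (toCochain φ)) = 0 from hφ,
      Fin.sum_univ_two] at h1
    have e0 : (fun i => ![x, y] ((0 : Fin 2).succAbove i)) = fun _ : Fin 1 => y :=
      funext fun i => by fin_cases i; rfl
    have e1 : (fun i => ![x, y] ((1 : Fin 2).succAbove i)) = fun _ : Fin 1 => x :=
      funext fun i => by fin_cases i; rfl
    rw [e0, e1] at h1
    simp only [Fin.val_zero, pow_zero, one_smul, Fin.val_one, pow_one, neg_smul,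
      ← sub_eq_add_neg] at h1
    exact (sub_eq_zero.1 h1.symm).symm
  refine ⟨(⟨fun X => φ.1 X (fun _ => 1), fun X Y f => ?_, fun X g => ?_⟩ : A.invariants), ?_⟩
  · refine (φ.2.1 f _).trans (congrArg (φ.1 X) (funext fun i => ?_))
    exact map_one _
  · exact (φ.2.2 X g _).symm.trans (h X _ _)
  · apply Subtype.ext
    funext X x
    refine (h X 1 (x 0)).trans (congrArg (φ.1 X) (funext fun i => ?_))
    rw [Subsingleton.elim i 0]

/-- The invariants are the zero-cocycles. -/
noncomputable def invariantsIsoCycles :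
    (globalSections J 𝒢).obj A ≅ ((homogeneousComplex J 𝒢).obj A).cycles 0 :=
  (invariantsToCochain_exact A).fIsKernel.conePointUniqueUpToIso
    (((homogeneousComplex J 𝒢).obj A).cyclesIsKernel 0 1 (by simp))

theorem invariantsIsoCycles_hom_iCycles :
    (invariantsIsoCycles A).hom ≫ ((homogeneousComplex J 𝒢).obj A).iCycles 0 =
      invariantsToCochain A :=
  (invariantsToCochain_exact A).fIsKernel.conePointUniqueUpToIso_hom_comp
    (((homogeneousComplex J 𝒢).obj A).cyclesIsKernel 0 1 (by simp)) WalkingParallelPair.zero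

variable {A}

theorem invariantsIsoCycles_naturality {B : EquivariantSheaf J 𝒢 AddCommGrpCat.{max u v}}
    (f : A ⟶ B) : (globalSections J 𝒢).map f ≫ (invariantsIsoCycles B).hom =
      (invariantsIsoCycles A).hom ≫ cyclesMap ((homogeneousComplex J 𝒢).map f) 0 := by
  rw [← cancel_mono (((homogeneousComplex J 𝒢).obj B).iCycles 0), Category.assoc, Category.assoc,
    cyclesMap_i, invariantsIsoCycles_hom_iCycles, ← Category.assoc,
    invariantsIsoCycles_hom_iCycles]
  rfl

end ZeroCocycles

section Exactness

variable (J 𝒢) in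
/-- The functor of sections over `X`. -/
noncomputable def sections (X : C) :
    EquivariantSheaf J 𝒢 AddCommGrpCat.{max u v} ⥤ AddCommGrpCat.{max u v} :=
  toSheafTwist J 𝒢 _ ⋙ sheafToPresheaf _ _ ⋙ (evaluation _ _).obj (op ⟨X⟩)

instance (X : C) : PreservesFiniteLimits (sections J 𝒢 X) := by
  dsimp only [sections]
  infer_instance

instance (X : C) : (sections J 𝒢 X).Additive where
  map_add := rfl

theorem app_injective {A B : EquivariantSheaf J 𝒢 AddCommGrpCat.{max u v}} (f : A ⟶ B) [Mono f]
    (X : C) : Function.Injective (f.hom.hom.app (op X)) := by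
  have : Mono ((sections J 𝒢 X).map f) := inferInstance
  exact (AddCommGrpCat.mono_iff_injective _).1 this

theorem exists_app_eq {S : ShortComplex (EquivariantSheaf J 𝒢 AddCommGrpCat.{max u v})}
    (hS : S.ShortExact) (X : C) (a : S.X₂.sheaf.obj.obj (op X))
    (ha : S.g.hom.hom.app (op X) a = 0) :
    ∃ b : S.X₁.sheaf.obj.obj (op X), S.f.hom.hom.app (op X) b = a := by
  have h := hS.exact.map_of_mono_of_preservesKernel (sections J 𝒢 X) hS.mono_f inferInstance
  rw [ShortComplex.ab_exact_iff] at h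
  exact h a ha

/-- Left exactness is inherited from the left exactness of `sections`; only surjectivity depends on
the site, and it enters as `hepi`. -/
theorem shortExact_homogeneousComplex
    (hepi : ∀ {A B : EquivariantSheaf J 𝒢 AddCommGrpCat.{max u v}} (f : A ⟶ B) [Epi f] (p : ℕ),
      Function.Surjective (homogeneousCochainsMap f (Fin (p + 1))))
    (S : ShortComplex (EquivariantSheaf J 𝒢 AddCommGrpCat.{max u v})) (hS : S.ShortExact) :
    (S.map (homogeneousComplex J 𝒢)).ShortExact := by
  refine shortExact_of_degreewise_shortExact _ fun p => ?_
  have := hS.mono_f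
  have := hS.epi_g
  refine ShortComplex.ShortExact.mk' ?_ ?_ ?_
  · rw [ShortComplex.ab_exact_iff]
    intro (φ : S.X₂.homogeneousCochains (Fin (p + 1))) hφ
    have h : ∀ (X : C) (x : Fin (p + 1) → 𝒢.obj (op X)), S.g.hom.hom.app (op X) (φ.1 X x) = 0 :=
      fun X x => congrArg (fun ψ : S.X₃.homogeneousCochains (Fin (p + 1)) => ψ.1 X x) hφ
    -- The pointwise preimages are unique since `S.f` is injective on sections, so the chosen family
    -- is automatically natural and equivariant.
    choose ψ hψ using fun (X : C) (x : Fin (p + 1) → 𝒢.obj (op X)) => exists_app_eq hS X _ (h X x)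
    refine ⟨(⟨ψ, fun X Y f x => ?_, fun X g x => ?_⟩ :
      S.X₁.homogeneousCochains (Fin (p + 1))), ?_⟩
    · apply app_injective S.f X
      refine (ConcreteCategory.congr_hom (S.f.hom.hom.naturality f.op) _).trans ?_
      refine Eq.trans ?_ ((φ.2.1 f x).trans (hψ X _).symm)
      exact congrArg (S.X₂.sheaf.obj.map f.op) (hψ Y x)
    · apply app_injective S.f X
      refine Eq.trans ?_ (ConcreteCategory.congr_hom (S.f.comm (op X) g) _).symm
      refine (hψ X _).trans ((φ.2.2 X g x).trans ?_)
      exact congrArg (S.X₂.actHom g) (hψ X x).symm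
    · apply Subtype.ext
      funext X x
      exact hψ X x
  · rw [AddCommGrpCat.mono_iff_injective]
    intro (φ : S.X₁.homogeneousCochains (Fin (p + 1))) ψ h
    apply Subtype.ext
    funext X x
    apply app_injective S.f X
    exact congrArg (fun ψ : S.X₂.homogeneousCochains (Fin (p + 1)) => ψ.1 X x) h
  · rw [AddCommGrpCat.epi_iff_surjective]
    exact hepi S.g p

end Exactness

end EquivariantSheaf

end HomogeneousCochains

/-! ### Acyclicity of homogeneous cochains with injective coefficients -/

section HomogeneousCochains

open Limits HomologicalComplex

variable {C : Type u} [Category.{v} C] {J : GrothendieckTopology C} {𝒢 : Cᵒᵖ ⥤ GrpCat.{v}}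

namespace Twist

variable (𝒢) in
/-- The presheaf on the twisted site of free abelian groups on tuples of sections of `𝒢`, with
`𝒢` acting diagonally. -/
def freeTuples (ι : Type) : (Twist 𝒢)ᵒᵖ ⥤ AddCommGrpCat.{max u v} where
  obj Y := AddCommGrpCat.of (FreeAbelianGroup (ULift.{u} (ι → 𝒢.obj (op Y.unop.base))))
  map f := AddCommGrpCat.ofHom (FreeAbelianGroup.map fun x =>
    ⟨fun i => f.unop.tw * 𝒢.map f.unop.base.op (x.down i)⟩)
  map_id Y := by
    refine AddCommGrpCat.hom_ext (FreeAbelianGroup.lift_ext _ _ fun x => ?_)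
    refine (FreeAbelianGroup.map_of_apply _).trans (congrArg FreeAbelianGroup.of ?_)
    apply ULift.down_injective
    funext i
    simp
  map_comp f g := by
    refine AddCommGrpCat.hom_ext (FreeAbelianGroup.lift_ext _ _ fun x => ?_)
    refine (FreeAbelianGroup.map_of_apply _).trans (Eq.trans ?_ (congrArg
      (FreeAbelianGroup.map _) (FreeAbelianGroup.map_of_apply _)).symm)
    refine Eq.trans (congrArg FreeAbelianGroup.of ?_) (FreeAbelianGroup.map_of_apply _).symm
    apply ULift.down_injective
    funext i
    simp [mul_assoc]

/-- The map on tuples induced by a map of index sets. -/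
def freeTuplesMap {ι κ : Type} (s : ι → κ) : freeTuples 𝒢 κ ⟶ freeTuples 𝒢 ι where
  app Y := AddCommGrpCat.ofHom (FreeAbelianGroup.map fun x => ⟨fun i => x.down (s i)⟩)
  naturality Y Z f := by
    refine AddCommGrpCat.hom_ext (FreeAbelianGroup.lift_ext _ _ fun x => ?_)
    refine (congrArg (FreeAbelianGroup.map _) (FreeAbelianGroup.map_of_apply _)).trans (Eq.trans ?_
      (congrArg (FreeAbelianGroup.map _) (FreeAbelianGroup.map_of_apply _)).symm)
    exact (FreeAbelianGroup.map_of_apply _).trans (FreeAbelianGroup.map_of_apply _).symm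

variable (𝒢) in
/-- The differential on tuples. -/
def freeTuplesD (n : ℕ) : freeTuples 𝒢 (Fin (n + 2)) ⟶ freeTuples 𝒢 (Fin (n + 1)) :=
  ∑ j : Fin (n + 2), (-1 : ℤ) ^ (j : ℕ) • freeTuplesMap j.succAbove

/-- The generator of `freeTuples` given by a tuple. -/
def tuple {ι : Type} {Y : (Twist 𝒢)ᵒᵖ} (x : ι → 𝒢.obj (op Y.unop.base)) :
    (freeTuples 𝒢 ι).obj Y :=
  FreeAbelianGroup.of ⟨x⟩

theorem freeTuples_hom_ext {ι : Type} {Y : (Twist 𝒢)ᵒᵖ} {A : AddCommGrpCat.{max u v}}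
    {f g : (freeTuples 𝒢 ι).obj Y ⟶ A} (h : ∀ x, f (tuple x) = g (tuple x)) : f = g :=
  AddCommGrpCat.hom_ext (FreeAbelianGroup.lift_ext _ _ fun x => h x.down)

theorem freeTuples_map_tuple {ι : Type} {Y Z : (Twist 𝒢)ᵒᵖ} (f : Y ⟶ Z)
    (x : ι → 𝒢.obj (op Y.unop.base)) : (freeTuples 𝒢 ι).map f (tuple x) =
      tuple fun i => f.unop.tw * 𝒢.map f.unop.base.op (x i) :=
  FreeAbelianGroup.map_of_apply _

theorem freeTuplesD_tuple (n : ℕ) {Y : (Twist 𝒢)ᵒᵖ} (x : Fin (n + 2) → 𝒢.obj (op Y.unop.base)) :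
    (freeTuplesD 𝒢 n).app Y (tuple x) =
      ∑ j : Fin (n + 2), (-1 : ℤ) ^ (j : ℕ) • tuple fun i => x (j.succAbove i) := by
  let ev : (freeTuples 𝒢 (Fin (n + 2)) ⟶ freeTuples 𝒢 (Fin (n + 1))) →+
      (freeTuples 𝒢 (Fin (n + 1))).obj Y :=
    { toFun D := D.app Y (tuple x)
      map_zero' := rfl
      map_add' _ _ := rfl }
  change ev (∑ j : Fin (n + 2), (-1 : ℤ) ^ (j : ℕ) • freeTuplesMap j.succAbove) = _
  rw [map_sum]
  refine Finset.sum_congr rfl fun j _ => ?_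
  rw [map_zsmul]
  exact congrArg _ (FreeAbelianGroup.map_of_apply _)

/-- Inserting the unit section in front of a tuple. -/
def freeTuplesCons (n : ℕ) (Y : (Twist 𝒢)ᵒᵖ) :
    (freeTuples 𝒢 (Fin n)).obj Y ⟶ (freeTuples 𝒢 (Fin (n + 1))).obj Y :=
  AddCommGrpCat.ofHom (FreeAbelianGroup.map fun x => ⟨Fin.cons 1 x.down⟩)

theorem freeTuplesCons_tuple {n : ℕ} {Y : (Twist 𝒢)ᵒᵖ} (x : Fin n → 𝒢.obj (op Y.unop.base)) :
    freeTuplesCons n Y (tuple x) = tuple (Fin.cons 1 x) :=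
  FreeAbelianGroup.map_of_apply _

/-- This is the standard contraction of `E_•G`: the zeroth face of the extended tuple gives the
tuple back, and the remaining faces cancel against the second term. Prepending the unit does not
commute with the action of `𝒢`, so the homotopy exists only for each `Y` separately; that suffices,
since exactness of presheaves is tested objectwise. -/
theorem freeTuples_homotopy (n : ℕ) (Y : (Twist 𝒢)ᵒᵖ) :
    freeTuplesCons (n + 2) Y ≫ (freeTuplesD 𝒢 (n + 1)).app Y +
      (freeTuplesD 𝒢 n).app Y ≫ freeTuplesCons (n + 1) Y = 𝟙 _ := by
  refine freeTuples_hom_ext fun x => ?_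
  change (freeTuplesD 𝒢 (n + 1)).app Y (freeTuplesCons (n + 2) Y (tuple x)) +
    freeTuplesCons (n + 1) Y ((freeTuplesD 𝒢 n).app Y (tuple x)) = tuple x
  rw [freeTuplesCons_tuple, freeTuplesD_tuple, freeTuplesD_tuple, map_sum, Fin.sum_univ_succ]
  refine (add_assoc _ _ _).trans ?_
  rw [← Finset.sum_add_distrib, Finset.sum_eq_zero, add_zero]
  · simp
  · intro j _
    rw [map_zsmul, freeTuplesCons_tuple]
    have : (fun i => (Fin.cons 1 x : Fin (n + 3) → 𝒢.obj (op Y.unop.base)) (j.succ.succAbove i)) =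
        Fin.cons 1 fun i => x (j.succAbove i) := by
      funext i
      refine Fin.cases ?_ (fun i => ?_) i
      · simp
      · simp
    rw [this, Fin.val_succ, pow_succ, mul_neg_one, neg_smul, neg_add_cancel]

theorem exists_freeTuplesD_eq {n : ℕ} {Y : (Twist 𝒢)ᵒᵖ} (z : (freeTuples 𝒢 (Fin (n + 2))).obj Y)
    (hz : (freeTuplesD 𝒢 n).app Y z = 0) :
    ∃ w, (freeTuplesD 𝒢 (n + 1)).app Y w = z := by
  refine ⟨freeTuplesCons (n + 2) Y z, ?_⟩
  have h : (freeTuplesD 𝒢 (n + 1)).app Y (freeTuplesCons (n + 2) Y z) +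
      freeTuplesCons (n + 1) Y ((freeTuplesD 𝒢 n).app Y z) = z :=
    ConcreteCategory.congr_hom (freeTuples_homotopy n Y) z
  rwa [hz, map_zero, add_zero] at h

end Twist

namespace EquivariantSheaf

open Twist

variable {A : EquivariantSheaf J 𝒢 AddCommGrpCat.{max u v}}

/-- The morphism of presheaves on the twisted site attached to a homogeneous cochain. -/
def homogeneousCochainsHom {ι : Type} (φ : A.homogeneousCochains ι) :
    freeTuples 𝒢 ι ⟶ A.toPresheaf where
  app Y := AddCommGrpCat.ofHom (FreeAbelianGroup.lift fun x => φ.1 Y.unop.base x.down)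
  naturality Y Z f := by
    refine freeTuples_hom_ext fun x => ?_
    refine (congrArg (FreeAbelianGroup.lift _) (freeTuples_map_tuple f x)).trans ?_
    refine (FreeAbelianGroup.lift_apply_of _ _).trans (Eq.trans ?_ (congrArg (A.toPresheaf.map f)
      (FreeAbelianGroup.lift_apply_of _ _)).symm)
    refine (φ.2.2 _ _ _).trans (congrArg (A.actHom f.unop.tw) ?_)
    exact (φ.2.1 f.unop.base x).symm

theorem homogeneousCochainsHom_tuple {ι : Type} (φ : A.homogeneousCochains ι)
    {Y : (Twist 𝒢)ᵒᵖ} (x : ι → 𝒢.obj (op Y.unop.base)) :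
    (homogeneousCochainsHom φ).app Y (tuple x) = φ.1 Y.unop.base x :=
  FreeAbelianGroup.lift_apply_of _ _

/-- Under the correspondence of cochains with morphisms out of `freeTuples`, the coboundary is
precomposition with `freeTuplesD`. -/
theorem freeTuplesD_comp_homogeneousCochainsHom {n : ℕ}
    (φ : A.homogeneousCochains (Fin (n + 1))) :
    freeTuplesD 𝒢 n ≫ homogeneousCochainsHom φ = homogeneousCochainsHom
      (ofCochain (((homogeneousComplex J 𝒢).obj A).d n (n + 1) (toCochain φ))) := by
  ext Y : 2
  refine freeTuples_hom_ext fun x => ?_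
  rw [homogeneousCochainsHom_tuple, homogeneousComplex_d_apply]
  change (homogeneousCochainsHom φ).app Y ((freeTuplesD 𝒢 n).app Y (tuple x)) = _
  rw [freeTuplesD_tuple, map_sum]
  refine Finset.sum_congr rfl fun j _ => ?_
  rw [map_zsmul, homogeneousCochainsHom_tuple]
  rfl

/-- The homogeneous cochain attached to a morphism of presheaves on the twisted site. -/
def homogeneousCochainsOfHom {ι : Type} (ψ : freeTuples 𝒢 ι ⟶ A.toPresheaf) :
    A.homogeneousCochains ι where
  val X x := ψ.app (op ⟨X⟩) (tuple x)
  property := by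
    refine ⟨fun X Y f x => ?_, fun X g x => ?_⟩
    · have h := ConcreteCategory.congr_hom (ψ.naturality
        (X := op ⟨Y⟩) (Y := op ⟨X⟩) ((Twist.incl 𝒢).map f).op) (tuple x)
      have e : A.toPresheaf.map ((Twist.incl 𝒢).map f).op (ψ.app (op ⟨Y⟩) (tuple x)) =
          A.sheaf.obj.map f.op (ψ.app (op ⟨Y⟩) (tuple x)) :=
        ConcreteCategory.congr_hom (A.toPresheaf_map_incl f) _
      refine e.symm.trans (h.symm.trans (congrArg (ψ.app (op ⟨X⟩)) ?_))
      refine (freeTuples_map_tuple _ _).trans (congrArg tuple (funext fun i => ?_))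
      exact one_mul _
    · have h := ConcreteCategory.congr_hom (ψ.naturality
        (X := op ⟨X⟩) (Y := op ⟨X⟩) (Twist.homMk (𝟙 _) g : (⟨X⟩ : Twist 𝒢) ⟶ ⟨X⟩).op) (tuple x)
      have e : A.toPresheaf.map (Twist.homMk (𝟙 _) g : (⟨X⟩ : Twist 𝒢) ⟶ ⟨X⟩).op
          (ψ.app (op ⟨X⟩) (tuple x)) = A.actHom g (ψ.app (op ⟨X⟩) (tuple x)) := by
        have : A.toPresheaf.map (Twist.homMk (𝟙 _) g : (⟨X⟩ : Twist 𝒢) ⟶ ⟨X⟩).op = A.actHom g := by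
          simp [toPresheaf]
        exact ConcreteCategory.congr_hom this _
      refine Eq.trans (congrArg (ψ.app (op ⟨X⟩)) ?_) (h.trans e)
      refine Eq.trans ?_ (freeTuples_map_tuple _ _).symm
      refine congrArg tuple (funext fun i => ?_)
      simp

/-- The inclusion of sheaves into presheaves has an exact left adjoint, sheafification, so it
preserves injectives. Thus the free presheaves need not be sheafified in the acyclicity argument. -/
theorem injective_toPresheaf (A : EquivariantSheaf J 𝒢 AddCommGrpCat.{max u v}) [Injective A] :
    Injective A.toPresheaf := by
  have h1 : Injective ((toSheafTwist J 𝒢 _).obj A) :=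
    Injective.injective_of_adjoint (toSheafTwist J 𝒢 _).asEquivalence.symm.toAdjunction A
  exact Injective.injective_of_adjoint (sheafificationAdjunction (Twist.topology 𝒢 J)
    AddCommGrpCat.{max u v}) ((toSheafTwist J 𝒢 _).obj A)

/-- `Hom` into an injective object is exact, and the complex of free presheaves on tuples is exact.
-/
theorem exactAt_homogeneousComplex (A : EquivariantSheaf J 𝒢 AddCommGrpCat.{max u v})
    [Injective A] (n : ℕ) : ((homogeneousComplex J 𝒢).obj A).ExactAt (n + 1) := by
  rw [HomologicalComplex.exactAt_iff' _ n (n + 1) (n + 2) (by simp) (by simp),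
    ShortComplex.ab_exact_iff]
  intro (φ : A.homogeneousCochains (Fin (n + 2))) hφ
  have hφ' : freeTuplesD 𝒢 (n + 1) ≫ homogeneousCochainsHom φ = 0 := by
    rw [freeTuplesD_comp_homogeneousCochainsHom]
    ext Y : 2
    refine freeTuples_hom_ext fun x => ?_
    rw [homogeneousCochainsHom_tuple]
    exact congrArg (fun ψ : A.homogeneousCochains (Fin (n + 3)) => ψ.1 Y.unop.base x) hφ
  -- The kernel of `freeTuplesD 𝒢 n` is objectwise the image of the next differential, which `φ`
  -- kills. Hence `φ` factors through the image of `freeTuplesD 𝒢 n` and extends to all of its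
  -- target by injectivity; the extension is the primitive.
  have hk : kernel.ι (freeTuplesD 𝒢 n) ≫ homogeneousCochainsHom φ = 0 := by
    ext Y k
    have h1 : (freeTuplesD 𝒢 n).app Y ((kernel.ι (freeTuplesD 𝒢 n)).app Y k) = 0 :=
      ConcreteCategory.congr_hom (NatTrans.congr_app (kernel.condition (freeTuplesD 𝒢 n)) Y) k
    obtain ⟨w, hw⟩ := exists_freeTuplesD_eq _ h1
    change (homogeneousCochainsHom φ).app Y ((kernel.ι (freeTuplesD 𝒢 n)).app Y k) = 0
    rw [← hw]
    exact ConcreteCategory.congr_hom (NatTrans.congr_app hφ' Y) w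
  have := injective_toPresheaf A
  let S : ShortComplex ((Twist 𝒢)ᵒᵖ ⥤ AddCommGrpCat.{max u v}) :=
    ShortComplex.mk _ _ (kernel.condition (freeTuplesD 𝒢 n))
  have hS : S.Exact := ShortComplex.exact_of_f_is_kernel _ (kernelIsKernel _)
  let ψ : freeTuples 𝒢 (Fin (n + 1)) ⟶ A.toPresheaf :=
    hS.descToInjective (homogeneousCochainsHom φ) hk
  have hψ : freeTuplesD 𝒢 n ≫ ψ = homogeneousCochainsHom φ := hS.comp_descToInjective _ hk
  refine ⟨toCochain (homogeneousCochainsOfHom ψ), ?_⟩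
  apply Subtype.ext
  funext X x
  refine (homogeneousComplex_d_apply A n (homogeneousCochainsOfHom ψ) X x).trans ?_
  have h := ConcreteCategory.congr_hom (NatTrans.congr_app hψ (op ⟨X⟩)) (tuple x)
  rw [homogeneousCochainsHom_tuple] at h
  refine Eq.trans ?_ h
  change _ = ψ.app (op ⟨X⟩) ((freeTuplesD 𝒢 n).app (op ⟨X⟩) (tuple x))
  rw [freeTuplesD_tuple, map_sum]
  refine Finset.sum_congr rfl fun j _ => ?_
  rw [map_zsmul]
  rfl

/-- Cohomology of equivariant sheaves is computed by homogeneous cochains as soon as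
epimorphisms are surjective on homogeneous cochains. -/
theorem exists_cohomology_iso
    (hepi : ∀ {A B : EquivariantSheaf J 𝒢 AddCommGrpCat.{max u v}} (f : A ⟶ B) [Epi f] (p : ℕ),
      Function.Surjective (homogeneousCochainsMap f (Fin (p + 1)))) (n : ℕ) :
    ∃ e : ∀ A, (cohomology J 𝒢 n).obj A ≅ ((homogeneousComplex J 𝒢).obj A).homology n,
      ∀ {A B : EquivariantSheaf J 𝒢 AddCommGrpCat.{max u v}} (f : A ⟶ B),
        (cohomology J 𝒢 n).map f ≫ (e B).hom =
          (e A).hom ≫ homologyMap ((homogeneousComplex J 𝒢).map f) n :=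
  IsEffaceableExact.nonempty_rightDerived_iso ⟨shortExact_homogeneousComplex hepi,
    fun A _ n => exactAt_homogeneousComplex A n⟩ (globalSections J 𝒢) invariantsIsoCycles
    invariantsIsoCycles_naturality n

end EquivariantSheaf

end HomogeneousCochains

/-! ### Partitions into open sets refining an open covering -/

section Ultraparacompact

open Topology Set

theorem exists_dist_lt_imp_mem {X M : Type*} [TopologicalSpace X] [PseudoMetricSpace M]
    (e : OpenPartialHomeomorph X M) {y : X} (hy : y ∈ e.source) {U : Set X} (hU : U ∈ 𝓝 y) :
    ∃ δ > 0, ∀ z ∈ e.source, dist (e z) (e y) < δ → z ∈ U := by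
  have h : e.symm ⁻¹' U ∈ 𝓝 (e y) := by
    refine (e.continuousAt_symm (e.map_source hy)).preimage_mem_nhds ?_
    rwa [e.left_inv hy]
  obtain ⟨δ, hδ, hb⟩ := Metric.mem_nhds_iff.1 h
  refine ⟨δ, hδ, fun z hz hd => ?_⟩
  have : e.symm (e z) ∈ U := hb hd
  rwa [e.left_inv hz] at this

theorem eventually_dist_lt {X M : Type*} [TopologicalSpace X] [PseudoMetricSpace M]
    (e : OpenPartialHomeomorph X M) {y : X} (hy : y ∈ e.source) {δ : ℝ} (hδ : 0 < δ) :
    ∀ᶠ z in 𝓝 y, z ∈ e.source ∧ dist (e z) (e y) < δ :=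
  Filter.Eventually.and (e.open_source.mem_nhds hy)
    ((e.continuousAt hy).eventually (Metric.ball_mem_nhds _ hδ))

/-- Inside a chart with values in an ultrametric space, a closed set and an open neighbourhood of it
can be separated by a clopen set. -/
theorem exists_isClopen_between {X M : Type*} [TopologicalSpace X] [PseudoMetricSpace M]
    [IsUltrametricDist M] (e : OpenPartialHomeomorph X M) {F V : Set X} (hF : IsClosed F)
    (hV : IsOpen V) (hFV : F ⊆ V) (hVe : closure V ⊆ e.source) :
    ∃ D, IsClopen D ∧ F ⊆ D ∧ D ⊆ V := by
  -- Points of the chart that are nearer to some point of `F` than to every point of the chart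
  -- outside `V`.
  let D : Set X := { y | y ∈ e.source ∧
    ∃ f ∈ F, ∀ h ∈ e.source, h ∉ V → dist (e y) (e f) < dist (e y) (e h) }
  have hFs : F ⊆ e.source := hFV.trans (subset_closure.trans hVe)
  have hFD : F ⊆ D := by
    intro f hf
    refine ⟨hFs hf, f, hf, fun h hh hhV => ?_⟩
    obtain ⟨δ, hδ, hb⟩ := exists_dist_lt_imp_mem e (hFs hf) (hV.mem_nhds (hFV hf))
    rw [dist_self]
    by_contra hd
    refine hhV (hb h hh ?_)
    rw [dist_comm]
    exact (not_lt.1 hd).trans_lt hδ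
  have hDV : D ⊆ V := by
    rintro y ⟨hy, f, hf, h⟩
    by_contra hyV
    have := h y hy hyV
    rw [dist_self] at this
    exact this.not_ge dist_nonneg
  refine ⟨D, ⟨⟨?_⟩, ?_⟩, hFD, hDV⟩
  -- For `D` closed: near `y ∈ closure V` outside `D`, a chart ball of radius `δ` misses `F`. If
  -- some `z` in it had a witness `f`, the strong triangle inequality would give `d(y,f) ≤ d(z,f) <
  -- d(z,k) ≤ d(y,k)` for all `k` outside `V`, making `f` a witness for `y`. Away from `closure V`
  -- there is nothing to do, as `D ⊆ V`.
  · rw [isOpen_iff_mem_nhds]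
    intro y hyD
    by_cases hyV : y ∈ closure V
    · have hy := hVe hyV
      have hyF : y ∉ F := fun h => hyD (hFD h)
      obtain ⟨δ, hδ, hb⟩ := exists_dist_lt_imp_mem e hy (hF.isOpen_compl.mem_nhds hyF)
      filter_upwards [eventually_dist_lt e hy hδ] with z hz hzD
      obtain ⟨-, f, hf, h⟩ := hzD
      refine hyD ⟨hy, f, hf, fun k hk hkV => ?_⟩
      have h1 := h k hk hkV
      have h2 : δ ≤ dist (e f) (e y) := by
        by_contra hd
        exact hb f (hFs hf) (not_le.1 hd) hf
      have h3 := dist_triangle_max (e f) (e z) (e y)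
      have h4 : dist (e f) (e y) ≤ dist (e z) (e f) := by
        rw [dist_comm (e z)]
        rcases le_max_iff.1 h3 with h3 | h3
        · exact h3
        · exact absurd (h2.trans h3) (not_le.2 hz.2)
      have h5 := dist_triangle_max (e z) (e y) (e k)
      have h6 := dist_triangle_max (e y) (e z) (e k)
      rw [dist_comm (e y) (e f)]
      rcases le_max_iff.1 h5 with h5 | h5
      · linarith [hz.2]
      · linarith
    · filter_upwards [isClosed_closure.isOpen_compl.mem_nhds hyV] with z hz hzD
      exact hz (subset_closure (hDV hzD))
  · rw [isOpen_iff_mem_nhds]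
    rintro y ⟨hy, f, hf, h⟩
    have hyV : y ∈ V := hDV ⟨hy, f, hf, h⟩
    obtain ⟨δ, hδ, hb⟩ := exists_dist_lt_imp_mem e hy (hV.mem_nhds hyV)
    -- Every `k` outside `V` lies at distance at least this radius from `y`, so passing from `y` to
    -- a nearby `z` keeps the same witness `f`. The `δ` keeps the radius positive when `d(y,f) = 0`.
    filter_upwards [eventually_dist_lt e hy (lt_max_of_lt_left hδ : 0 < max δ (dist (e y) (e f)))]
      with z hz
    refine ⟨hz.1, f, hf, fun k hk hkV => ?_⟩
    have h1 := h k hk hkV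
    have h2 : δ ≤ dist (e y) (e k) := by
      by_contra hd
      refine hkV (hb k hk ?_)
      rw [dist_comm]
      exact not_le.1 hd
    have h3 : dist (e z) (e y) < dist (e y) (e k) := hz.2.trans_le (max_le h2 h1.le)
    have h4 := dist_triangle_max (e z) (e y) (e f)
    have h5 := dist_triangle_max (e y) (e z) (e k)
    rw [dist_comm (e y) (e z)] at h5
    have h6 : dist (e y) (e k) ≤ dist (e z) (e k) := by
      rcases le_max_iff.1 h5 with h5 | h5
      · exact absurd h5 (not_le.2 h3)
      · exact h5
    exact (h4.trans_lt (max_lt h3 h1)).trans_le h6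

/-- A paracompact Hausdorff space which is locally homeomorphic to an ultrametric space is strictly
paracompact: every open covering can be refined by a partition into open subsets. -/
theorem exists_isLocallyConstant_mem {X M : Type*} [TopologicalSpace X] [T2Space X]
    [ParacompactSpace X] [PseudoMetricSpace M] [IsUltrametricDist M]
    (he : ∀ x : X, ∃ e : OpenPartialHomeomorph X M, x ∈ e.source) (U : X → Set X)
    (hU : ∀ x, IsOpen (U x)) (hxU : ∀ x, x ∈ U x) :
    ∃ c : X → X, IsLocallyConstant c ∧ ∀ y, y ∈ U (c y) := by
  choose e hxe using he
  have h1 : ∀ x, ∃ W : Set X, IsOpen W ∧ x ∈ W ∧ closure W ⊆ U x ∩ (e x).source := by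
    intro x
    obtain ⟨W, hW, hWo, hWU⟩ := exists_mem_nhds_isClosed_subset
      (((hU x).inter (e x).open_source).mem_nhds ⟨hxU x, hxe x⟩)
    exact ⟨interior W, isOpen_interior, mem_interior_iff_mem_nhds.2 hW,
      (closure_minimal interior_subset hWo).trans hWU⟩
  choose W hWo hxW hWU using h1
  -- A locally finite refinement `V`, shrunk to a closed covering `F`, leaves room for clopen sets
  -- `D` with `F x ⊆ D x ⊆ V x`. These form a locally finite clopen covering.
  obtain ⟨V, hVo, hVc, hVf, hVW⟩ := precise_refinement W hWo
    (eq_univ_of_forall fun x => mem_iUnion.2 ⟨x, hxW x⟩)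
  obtain ⟨F, hFc, hFcl, hFV⟩ := exists_iUnion_eq_closed_subset hVo hVf.point_finite hVc
  have h2 : ∀ x, ∃ D, IsClopen D ∧ F x ⊆ D ∧ D ⊆ V x := fun x =>
    exists_isClopen_between (e x) (hFcl x) (hVo x) (hFV x)
      ((closure_mono (hVW x)).trans ((hWU x).trans inter_subset_right))
  choose D hD hFD hDV using h2
  have hDf : LocallyFinite D := hVf.subset hDV
  have hDc : ∀ y, ∃ x, y ∈ D x := fun y => by
    obtain ⟨x, hx⟩ := mem_iUnion.1 (hFc.ge (mem_univ y))
    exact ⟨x, hFD x hx⟩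
  -- To make the covering disjoint, send `y` to the least index `x` with `y ∈ D x`. The fibres are
  -- open because the union of the earlier `D x` is closed by local finiteness.
  let r : X → X → Prop := WellOrderingRel
  have hr : WellFounded r := IsWellFounded.wf
  let c : X → X := fun y => hr.min { x | y ∈ D x } (hDc y)
  have hc : ∀ y, y ∈ D (c y) := fun y => hr.min_mem { x | y ∈ D x } (hDc y)
  refine ⟨c, ?_, fun y => (hWU _).trans inter_subset_left (subset_closure (hVW _ (hDV _ (hc y))))⟩
  rw [IsLocallyConstant.iff_exists_open]
  intro y
  refine ⟨D (c y) ∩ (⋃ x : { x // r x (c y) }, D x)ᶜ, (hD _).isOpen.inter ?_, ⟨hc y, ?_⟩, ?_⟩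
  · refine IsClosed.isOpen_compl (self := LocallyFinite.isClosed_iUnion ?_ fun x => (hD _).isClosed)
    exact hDf.comp_injective Subtype.val_injective
  · rw [mem_compl_iff, mem_iUnion]
    rintro ⟨⟨x, hx⟩, hxD⟩
    exact hr.not_lt_min { x | y ∈ D x } hxD hx
  · rintro z ⟨hz, hz'⟩
    rw [mem_compl_iff, mem_iUnion, not_exists] at hz'
    rcases trichotomous_of r (c z) (c y) with h | h | h
    · exact absurd (hc z) (hz' ⟨c z, h⟩)
    · exact h
    · exact absurd h (hr.not_lt_min { x | z ∈ D x } hz)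

end Ultraparacompact

/-! ### Epimorphisms are surjective on sections and on cochains -/

section SurjectiveOnSections

open Limits

namespace EquivariantSheaf

section General

variable {C : Type u} [Category.{v} C] {J : GrothendieckTopology C} {𝒢 : Cᵒᵖ ⥤ GrpCat.{v}}
  {A B : EquivariantSheaf J 𝒢 AddCommGrpCat.{max u v}}

/-- Epimorphisms of equivariant sheaves are locally surjective. -/
theorem imageSieve_mem_of_epi (f : A ⟶ B) [Epi f] {X : C} (b : B.sheaf.obj.obj (op X)) :
    Presheaf.imageSieve f.hom.hom b ∈ J X := by
  have h : Sheaf.IsLocallySurjective ((toSheafTwist J 𝒢 _).map f) :=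
    (Sheaf.isLocallySurjective_iff_epi' AddCommGrpCat.{max u v}
      ((toSheafTwist J 𝒢 _).map f)).2 inferInstance
  refine J.superset_covering ?_ (h.imageSieve_mem (U := ⟨X⟩) b)
  rintro Y g ⟨a, ha⟩
  exact ⟨a, ha.trans (ConcreteCategory.congr_hom (B.toPresheaf_map_incl g) b)⟩

theorem isSheaf_forget (A : EquivariantSheaf J 𝒢 AddCommGrpCat.{max u v}) :
    Presieve.IsSheaf J (A.sheaf.obj ⋙ forget AddCommGrpCat.{max u v}) :=
  (isSheaf_iff_isSheaf_of_type _ _).1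
    ((Presheaf.isSheaf_iff_isSheaf_forget _ _ (forget AddCommGrpCat.{max u v})).1 A.sheaf.property)

theorem section_ext (A : EquivariantSheaf J 𝒢 AddCommGrpCat.{max u v}) {X : C} {S : Sieve X}
    (hS : S ∈ J X) {a b : A.sheaf.obj.obj (op X)}
    (h : ∀ ⦃Y : C⦄ (f : Y ⟶ X), S f → A.sheaf.obj.map f.op a = A.sheaf.obj.map f.op b) : a = b :=
  (A.isSheaf_forget S hS).isSeparatedFor.ext fun _ f hf => h f hf

/-- If `R` represents `𝒢^ι`, homogeneous cochains can be lifted along morphisms that are surjective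
on sections over `R`. -/
theorem homogeneousCochainsMap_surjective {ι : Type} (i₀ : ι) (f : A ⟶ B) (R : C)
    (t : ι → 𝒢.obj (op R)) (lift : ∀ {X : C} (_ : ι → 𝒢.obj (op X)), X ⟶ R)
    (lift_spec : ∀ {X : C} (x : ι → 𝒢.obj (op X)) (i : ι), 𝒢.map (lift x).op (t i) = x i)
    (comp_lift : ∀ {X Y : C} (g : Y ⟶ X) (x : ι → 𝒢.obj (op X)),
      g ≫ lift x = lift fun i => 𝒢.map g.op (x i))
    (hf : Function.Surjective (f.hom.hom.app (op R))) :
    Function.Surjective (homogeneousCochainsMap f ι) := by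
  intro ψ
  obtain ⟨a, ha⟩ := hf (ψ.1 R t)
  -- An arbitrary lift `a` of the universal value need not be equivariant. Translating a tuple by
  -- `(x i₀)⁻¹`, pulling back `a` and acting by `x i₀` forces equivariance, since `(x i₀)⁻¹ * x i`
  -- does not change under left translation. The result still lifts `ψ` because `ψ` is equivariant.
  refine ⟨⟨fun X x => A.actHom (x i₀) (A.sheaf.obj.map (lift fun i => (x i₀)⁻¹ * x i).op a),
    fun X Y g x => ?_, fun X g x => ?_⟩, ?_⟩
  · refine (ConcreteCategory.congr_hom (A.act_map g.op (x i₀)) _).trans ?_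
    refine congrArg (A.actHom (𝒢.map g.op (x i₀))) ?_
    refine (ConcreteCategory.congr_hom (A.sheaf.obj.map_comp _ _) a).symm.trans ?_
    have e : g ≫ lift (fun i => (x i₀)⁻¹ * x i) =
        lift fun i => (𝒢.map g.op (x i₀))⁻¹ * 𝒢.map g.op (x i) := by
      rw [comp_lift]
      congr 1
      funext i
      simp
    exact congrArg (fun h => A.sheaf.obj.map (Quiver.Hom.op h) a) e
  · have e : (fun i => (g * x i₀)⁻¹ * (g * x i)) = fun i => (x i₀)⁻¹ * x i := by
      funext i
      simp [mul_assoc]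
    beta_reduce
    rw [e]
    exact ConcreteCategory.congr_hom ((A.act (op X)).map_mul g (x i₀)) _
  · apply Subtype.ext
    funext X x
    refine (ConcreteCategory.congr_hom (f.comm (op X) (x i₀)) _).trans ?_
    refine Eq.trans (congrArg (B.actHom (x i₀)) ?_) ((ψ.2.2 X (x i₀) _).symm.trans
      (congrArg (ψ.1 X) (a₂ := x) (a₁ := fun i => x i₀ * ((x i₀)⁻¹ * x i)) ?_))
    · refine (ConcreteCategory.congr_hom (f.hom.hom.naturality _) a).trans ?_
      refine (congrArg (B.sheaf.obj.map _) ha).trans ((ψ.2.1 _ _).trans ?_)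
      exact congrArg (ψ.1 X) (funext fun i => lift_spec _ i)
    · funext i
      simp

end General

end EquivariantSheaf

namespace La

variable {K : Type u} [NontriviallyNormedField K]

theorem hom_ext {X Y : La K} {f g : X ⟶ Y} (h : ∀ x, fn f x = fn g x) : f = g :=
  ContMDiffMap.ext h

theorem toOpen_openIncl {X Y : La K} {U : TopologicalSpace.Opens X.carrier} [ParacompactSpace U]
    (f : Y ⟶ X) (h : ∀ y, fn f y ∈ U) : toOpen f h ≫ X.openIncl U = f :=
  hom_ext fun _ => rfl

theorem comp_toOpen_eq {X Y Y' Z : La K} {U : TopologicalSpace.Opens X.carrier} [ParacompactSpace U]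
    (f : Y ⟶ X) (h : ∀ y, fn f y ∈ U) (f' : Y' ⟶ X) (h' : ∀ y, fn f' y ∈ U) (g : Z ⟶ Y)
    (g' : Z ⟶ Y') (e : g ≫ f = g' ≫ f') : g ≫ toOpen f h = g' ≫ toOpen f' h' :=
  hom_ext fun z => Subtype.ext (congrArg (fun k => fn k z) e)

variable [CompleteSpace K] [IsUltrametricDist K]

/-- The norm of the model space need not be ultrametric, so the charts are composed with a linear
homeomorphism onto `Kⁿ` with the sup norm. -/
theorem exists_isLocallyConstant_mem (X : La K) (U : X.carrier → TopologicalSpace.Opens X.carrier)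
    (hxU : ∀ x, x ∈ U x) : ∃ c : X.carrier → X.carrier, IsLocallyConstant c ∧ ∀ y, y ∈ U (c y) :=
  LocAnCoh.exists_isLocallyConstant_mem (M := Fin (Module.finrank K X.model) → K)
    (fun x => ⟨(chartAt X.model x).transHomeomorph
      (Module.finBasis K X.model).equivFunL.toHomeomorph, mem_chart_source X.model x⟩)
    (fun x => U x) (fun x => (U x).isOpen) hxU

variable {𝒢 : (La K)ᵒᵖ ⥤ GrpCat.{u}}
  {A B : EquivariantSheaf (La.topology K) 𝒢 AddCommGrpCat.{u + 1}}

/-- An epimorphism of equivariant sheaves on `La` is surjective on sections over every manifold. -/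
theorem app_surjective (f : A ⟶ B) [Epi f] (X : La K) :
    Function.Surjective (f.hom.hom.app (op X)) := by
  intro b
  choose U hp hxU a ha using EquivariantSheaf.imageSieve_mem_of_epi f b
  obtain ⟨c, hc, hcU⟩ := X.exists_isLocallyConstant_mem U hxU
  -- The maps on which `c` is constant. Each lands in a single `U x`, so the local lift `a x` can be
  -- pulled back along it.
  let T : Sieve X :=
    { arrows := fun Y g => ∃ x, ∀ y, c (fn g y) = x
      downward_closed := fun {Y Z g} ⟨x, hx⟩ h => ⟨x, fun z => hx (fn h z)⟩ }
  have hT : T ∈ La.topology K X := by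
    intro x
    obtain ⟨V, hxV, hV, hVp⟩ := X.exists_paracompact (hc.isOpen_fiber (c x)) (x := x) rfl
    exact ⟨V, hVp, hxV, c x, fun y : V => hV y.2⟩
  let p : ∀ {Y : La K} (g : Y ⟶ X), T g → X.carrier := fun g hg => hg.choose
  have hpc : ∀ {Y : La K} (g : Y ⟶ X) (hg : T g) (y : Y.carrier), c (fn g y) = p g hg :=
    fun g hg => hg.choose_spec
  have hpU : ∀ {Y : La K} (g : Y ⟶ X) (hg : T g) (y : Y.carrier), fn g y ∈ U (p g hg) :=
    fun g hg y => hpc g hg y ▸ hcU _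
  let t : Presieve.FamilyOfElements (A.sheaf.obj ⋙ forget AddCommGrpCat.{u + 1}) T.arrows :=
    fun Y g hg => A.sheaf.obj.map (toOpen g (hpU g hg)).op (a (p g hg))
  have ht : t.Compatible := by
    intro Y₁ Y₂ Z g₁ g₂ f₁ f₂ h₁ h₂ e
    -- Over a nonempty overlap the constant values of `c` coincide, so the same local lift is
    -- restricted in two ways. Over an empty manifold the values are unrelated, but there the empty
    -- sieve covers and any two sections agree.
    have key : ∀ x₁ x₂ (k₁ : ∀ y, fn f₁ y ∈ U x₁) (k₂ : ∀ y, fn f₂ y ∈ U x₂),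
        (Nonempty Z.carrier → x₁ = x₂) →
        A.sheaf.obj.map g₁.op (A.sheaf.obj.map (toOpen f₁ k₁).op (a x₁)) =
        A.sheaf.obj.map g₂.op (A.sheaf.obj.map (toOpen f₂ k₂).op (a x₂)) := by
      intro x₁ x₂ k₁ k₂ hx
      by_cases hZ : Nonempty Z.carrier
      · obtain rfl := hx hZ
        refine (ConcreteCategory.congr_hom (A.sheaf.obj.map_comp _ _) _).symm.trans
          (Eq.trans ?_ (ConcreteCategory.congr_hom (A.sheaf.obj.map_comp _ _) _))
        exact congrArg (fun h => A.sheaf.obj.map (Quiver.Hom.op h) (a x₁))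
          (comp_toOpen_eq f₁ k₁ f₂ k₂ g₁ g₂ e)
      · refine A.section_ext (S := ⊥) (fun z => (hZ ⟨z⟩).elim) fun W h hh => hh.elim
    refine key _ _ _ _ fun ⟨z⟩ => ?_
    rw [← hpc f₁ h₁ (fn g₁ z), ← hpc f₂ h₂ (fn g₂ z)]
    exact congrArg (fun k => c (fn k z)) e
  obtain ⟨α, hα, -⟩ := A.isSheaf_forget T hT t ht
  refine ⟨α, B.section_ext hT fun Y g hg => ?_⟩
  refine (ConcreteCategory.congr_hom (f.hom.hom.naturality g.op) α).symm.trans ?_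
  refine (congrArg (f.hom.hom.app (op Y)) (hα g hg)).trans ?_
  refine (ConcreteCategory.congr_hom (f.hom.hom.naturality (toOpen g (hpU g hg)).op) _).trans ?_
  refine (congrArg (B.sheaf.obj.map _) (ha (p g hg))).trans ?_
  refine (ConcreteCategory.congr_hom (B.sheaf.obj.map_comp _ _) b).symm.trans ?_
  exact congrArg (fun h => B.sheaf.obj.map (Quiver.Hom.op h) b) (toOpen_openIncl g (hpU g hg))

end La

end SurjectiveOnSections

/-! ### The powers of `G` as manifolds representing tuples of sections -/

section PowerOfGroup

variable {K : Type u} [NontriviallyNormedField K]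
variable {E G : Type u} [NormedAddCommGroup E] [NormedSpace K E]
  [TopologicalSpace G] [ChartedSpace E G]

/-- A chart at `1` makes the neighbourhoods of `1` countably generated, hence also the uniformity; a
Hausdorff uniform space with countably generated uniformity is metrizable. -/
theorem metrizableSpace_of_isTopologicalGroup (E G : Type*) [NormedAddCommGroup E]
    [TopologicalSpace G] [ChartedSpace E G] [Group G] [IsTopologicalGroup G] [T2Space G] :
    TopologicalSpace.MetrizableSpace G := by
  let _ := IsTopologicalGroup.rightUniformSpace G
  have h1 : (nhds (1 : G)).IsCountablyGenerated := by
    have := (chartAt E (1 : G)).symm.map_nhds_eq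
      ((chartAt E (1 : G)).map_source (mem_chart_source E 1))
    rw [(chartAt E (1 : G)).left_inv (mem_chart_source E 1)] at this
    rw [← this]
    infer_instance
  have : (uniformity G).IsCountablyGenerated := by
    exact inferInstanceAs
      (Filter.comap (fun p : G × G => p.2 * p.1⁻¹) (nhds 1)).IsCountablyGenerated
  exact UniformSpace.metrizableSpace

/-- Cochains are defined with the product model and objects of `La` with the trivial one. This
equality mediates between the two notions of analyticity. -/
theorem modelWithCorners_pi_self (ι : Type) [Fintype ι] :
    (ModelWithCorners.pi (fun _ : ι => 𝓘(K, E)) : ModelWithCorners K (ι → E) (ι → E)) =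
      𝓘(K, ι → E) := by
  ext1
  · rfl
  · rfl
  · exact Set.pi_univ _
  · exact Set.pi_univ _

/-- A transition map between product charts is a product of transition maps of `G`, each depending
on a single coordinate. -/
theorem isManifold_pi (ι : Type) [Fintype ι] [IsManifold 𝓘(K, E) ω G] :
    @IsManifold K _ (ι → E) _ _ (ι → E) _ 𝓘(K, ι → E) ω (ι → G) _
      (piChartedSpace (fun _ => E) fun _ => G) := by
  let _ : ChartedSpace (ι → E) (ι → G) := piChartedSpace (fun _ => E) fun _ => G
  refine isManifold_of_contDiffOn 𝓘(K, ι → E) ω (ι → G) ?_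
  rintro _ _ ⟨e, he, rfl⟩ ⟨e', he', rfl⟩
  refine contDiffOn_pi.2 fun i => ?_
  have h := (contDiffGroupoid ω 𝓘(K, E)).compatible (he i trivial) (he' i trivial)
  rw [contDiffGroupoid, mem_groupoid_of_pregroupoid] at h
  have h' : ContDiffOn K ω ((e i).symm ≫ₕ e' i) ((e i).symm ≫ₕ e' i).source := by
    simpa [contDiffPregroupoid] using h.1
  refine h'.comp (contDiff_apply K E i).contDiffOn ?_
  rintro x ⟨⟨hx, hx'⟩, -⟩
  exact ⟨hx i trivial, hx' i trivial⟩

variable {E₁ H₁ M₁ : Type*} [NormedAddCommGroup E₁] [NormedSpace K E₁]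
  [TopologicalSpace H₁] [TopologicalSpace M₁] [ChartedSpace H₁ M₁] {I₁ : ModelWithCorners K E₁ H₁}

variable [FiniteDimensional K E] [T2Space G] [Group G] [LieGroup 𝓘(K, E) ω G]

/-- Finite powers of the metrizable group `G` are metrizable, hence paracompact. This makes `G^ι` an
object of `La`, where it represents the `ι`-tuples of sections of `y(G)`. -/
theorem paracompactSpace_pi (K E G : Type*) [NontriviallyNormedField K] [NormedAddCommGroup E]
    [NormedSpace K E] [TopologicalSpace G] [ChartedSpace E G] [T2Space G] [Group G]
    [LieGroup 𝓘(K, E) ω G] (ι : Type) [Fintype ι] : ParacompactSpace (ι → G) := by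
  have := topologicalGroup_of_lieGroup 𝓘(K, E) ω (G := G)
  have := metrizableSpace_of_isTopologicalGroup E G
  let _ := TopologicalSpace.metrizableSpaceMetric (ι → G)
  infer_instance

variable (K E G) in
/-- The manifold `G^ι`. -/
noncomputable def La.power (ι : Type) [Fintype ι] : La K :=
  haveI := paracompactSpace_pi K E G ι
  { carrier := ι → G
    model := ι → E
    chartedSpace := piChartedSpace (fun _ => E) fun _ => G
    isManifold := isManifold_pi ι }

variable {ι : Type} [Fintype ι]

theorem contMDiff_power_iff {f : M₁ → (La.power K E G ι).carrier} :
    ContMDiff I₁ (La.power K E G ι).I ω f ↔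
      ∀ i, ContMDiff I₁ 𝓘(K, E) ω (fun x => (f x : ι → G) i) := by
  have h : ContMDiff I₁ (La.power K E G ι).I ω f ↔
      ContMDiff (M' := ι → G) I₁ (ModelWithCorners.pi fun _ : ι => 𝓘(K, E)) ω f := by
    change @ContMDiff _ _ _ _ _ _ _ _ _ _ _ (ι → E) _ _ (ι → E) _ 𝓘(K, ι → E) (ι → G) _
      (piChartedSpace (fun _ => E) fun _ => G) _ _ ↔ _
    rw [← modelWithCorners_pi_self]
  exact h.trans contMDiff_pi_manifold

theorem isAnalytic_power_iff {V : Type u} [AddCommGroup V] [Module K V] [TopologicalSpace V]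
    {f : (ι → G) → V} :
    IsAnalytic (M := (La.power K E G ι).carrier) (La.power K E G ι).I f ↔
      IsAnalytic (ModelWithCorners.pi fun _ : ι => 𝓘(K, E)) f := by
  change @IsAnalytic _ _ _ _ _ _ (ι → E) (ι → E) (ι → G) _ _ _ _
      (piChartedSpace (fun _ => E) fun _ => G) 𝓘(K, ι → E) _ ↔ _
  rw [← modelWithCorners_pi_self]

variable (K E G) in
/-- The coordinates of `G^ι`, as sections of `y(G)`. -/
noncomputable def La.coord (i : ι) : (yG K E G).obj (op (La.power K E G ι)) :=
  (⟨fun x => (x : ι → G) i, contMDiff_power_iff.1 contMDiff_id i⟩ :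
    C^ω⟮(La.power K E G ι).I, (La.power K E G ι).carrier; 𝓘(K, E), G⟯)

/-- The underlying map of a section of `y(G)`. -/
def yG.fn {X : La K} (g : (yG K E G).obj (op X)) : C^ω⟮X.I, X.carrier; 𝓘(K, E), G⟯ := g

/-- The map to `G^ι` with given coordinates. -/
noncomputable def La.powerLift {X : La K} (x : ι → (yG K E G).obj (op X)) :
    X ⟶ La.power K E G ι :=
  (⟨fun p i => yG.fn (x i) p, contMDiff_power_iff.2 fun i => (yG.fn (x i)).contMDiff⟩ :
    C^ω⟮X.I, X.carrier; (La.power K E G ι).I, (La.power K E G ι).carrier⟯)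

theorem La.homogeneousCochainsMap_surjective [CompleteSpace K] [IsUltrametricDist K]
    {A B : EquivariantSheaf (La.topology K) (yG K E G) AddCommGrpCat.{u + 1}} (f : A ⟶ B) [Epi f]
    (p : ℕ) : Function.Surjective (EquivariantSheaf.homogeneousCochainsMap f (Fin (p + 1))) :=
  EquivariantSheaf.homogeneousCochainsMap_surjective 0 f (La.power K E G (Fin (p + 1)))
    (La.coord K E G) La.powerLift (fun _ _ => rfl) (fun _ _ => rfl) (La.app_surjective f _)

end PowerOfGroup

/-! ### Transport of cohomology and scalars from abelian groups to `K`-modules -/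

section Scalars

open HomologicalComplex

variable {K : Type u} [CommRing K]

variable (K) in
/-- The underlying abelian group of a module, in a larger universe. -/
abbrev uliftAbelianGroup : ModuleCat.{u} K ⥤ AddCommGrpCat.{max u v} :=
  forget₂ (ModuleCat.{u} K) AddCommGrpCat.{u} ⋙ AddCommGrpCat.uliftFunctor.{v, u}

/-- A cochain complex of abelian groups which is isomorphic to a cochain complex of modules has the
same cohomology, and endomorphisms inducing multiplication by a scalar on cochains do so on
cohomology. -/
theorem exists_homology_addEquiv (C : CochainComplex (ModuleCat.{u} K) ℕ)
    (D : CochainComplex AddCommGrpCat.{max u v} ℕ) (e : ∀ p, D.X p ≃+ C.X p)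
    (he : ∀ p x, e (p + 1) (D.d p (p + 1) x) = C.d p (p + 1) (e p x)) (i : ℕ) :
    ∃ E : D.homology i ≃+ C.homology i, ∀ (c : K) (f : D ⟶ D),
      (∀ p x, e p (f.f p x) = c • e p x) → ∀ x, E (homologyMap f i x) = c • E x := by
  -- `F` is exact and so commutes with cohomology. It remains to carry `f` to `F(c • 𝟙)` on
  -- cochains, and to use that cohomology of complexes of modules is a linear functor.
  let F := uliftAbelianGroup.{v, u} K
  have : F.Additive := inferInstance
  have : F.PreservesHomology := inferInstance
  let φ : D ≅ (F.mapHomologicalComplex _).obj C :=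
    HomologicalComplex.Hom.isoOfComponents
      (fun p => ((e p).trans AddEquiv.ulift.symm).toAddCommGrpIso) (by
        rintro p _ rfl
        ext x
        exact congrArg ULift.up (he p x).symm)
  let ψ := (homologyFunctor _ _ i).mapIso φ ≪≫ (C.sc i).mapHomologyIso F
  refine ⟨ψ.addCommGroupIsoToAddEquiv.trans AddEquiv.ulift, fun c f hf x => ?_⟩
  have h1 : f ≫ φ.hom = φ.hom ≫ (F.mapHomologicalComplex _).map (c • 𝟙 C) := by
    ext p x
    exact congrArg ULift.up (hf p x)
  have h2 : homologyMap f i ≫ ψ.hom = ψ.hom ≫ F.map (c • 𝟙 (C.homology i)) := by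
    have h3 : homologyMap (c • 𝟙 C) i = c • 𝟙 (C.homology i) :=
      (ShortComplex.homologyMap_smul ((shortComplexFunctor _ _ i).map (𝟙 C)) c).trans
        (congrArg (c • ·) (homologyMap_id C i))
    have h4 := ShortComplex.mapHomologyIso_hom_naturality
      ((shortComplexFunctor _ _ i).map (c • 𝟙 C)) F
    refine Eq.trans ?_ (congrArg (fun k => ψ.hom ≫ F.map k) h3)
    refine Eq.trans ?_ ((congrArg (homologyMap φ.hom i ≫ ·) h4).trans (Category.assoc _ _ _).symm)
    refine (Category.assoc _ _ _).symm.trans (Eq.trans ?_ (Category.assoc _ _ _))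
    refine congrArg (· ≫ ((C.sc i).mapHomologyIso F).hom) ?_
    exact (homologyMap_comp f φ.hom i).symm.trans ((congrArg (homologyMap · i) h1).trans
      (homologyMap_comp φ.hom _ i))
  exact congrArg ULift.down (ConcreteCategory.congr_hom h2 x)

end Scalars

/-! ### Cochains with values in `V̲` are analytic cochains -/

section Comparison

variable {K : Type u} [NontriviallyNormedField K]
variable {E G : Type u} [NormedAddCommGroup E] [NormedSpace K E]
  [TopologicalSpace G] [ChartedSpace E G] [Group G]
variable {V : Type u} [AddCommGroup V] [Module K V] [TopologicalSpace V]
  [IsTopologicalAddGroup V] [T2Space V]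

theorem cochainComplex_d_apply (ρ : G →* (V ≃L[K] V)) (p : ℕ) (f : cochains E ρ (Fin (p + 1)))
    (x : Fin (p + 2) → G) :
    (show cochains E ρ (Fin (p + 2)) from (cochainComplex E ρ).d p (p + 1) f).1 x =
      ∑ j : Fin (p + 2), (-1 : ℤ) ^ (j : ℕ) • f.1 fun i => x (j.succAbove i) := by
  have : (cochainComplex E ρ).d p (p + 1) =
      ∑ i : Fin (p + 2), (-1 : ℤ) ^ (i : ℕ) • (cosimplicialCochains E ρ).δ i :=
    CochainComplex.of_d (fun n => (cosimplicialCochains E ρ).obj (.mk n))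
      (AlgebraicTopology.AlternatingCofaceMapComplex.objD _) p
  rw [this]
  let ev : ((cosimplicialCochains E ρ).obj (.mk p) ⟶
      (cosimplicialCochains E ρ).obj (.mk (p + 1))) →+ V :=
    { toFun D := (show cochains E ρ (Fin (p + 2)) from D f).1 x
      map_zero' := rfl
      map_add' _ _ := rfl }
  change ev _ = _
  rw [map_sum]
  refine Finset.sum_congr rfl fun j _ => ?_
  rw [map_zsmul]
  rfl

variable [FiniteDimensional K E] [T2Space G] [LieGroup 𝓘(K, E) ω G]

/-- A constant section of `y(G)`. -/
def yG.const (X : La K) (g : G) : (yG K E G).obj (op X) :=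
  (⟨fun _ => g, contMDiff_const⟩ : C^ω⟮X.I, X.carrier; 𝓘(K, E), G⟯)

/-- Homogeneous cochains with values in `V̲` are the equivariant analytic functions. -/
noncomputable def homogeneousCochainsEquiv (ρ : G →* (V ≃L[K] V)) (ι : Type) [Fintype ι] :
    (admissibleSheaf E ρ).homogeneousCochains ι ≃+ cochains E ρ ι where
  toFun φ := ⟨(φ.1 (La.power K E G ι) (La.coord K E G)).down.1,
    isAnalytic_power_iff.1 (φ.1 (La.power K E G ι) (La.coord K E G)).down.2.1, fun g x => by
      -- `s` is left translation by `g` on `G^ι`. Naturality along `s` together with equivariance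
      -- under the constant section `g` gives equivariance of the function.
      let s := La.powerLift fun i => yG.const (La.power K E G ι) g * La.coord K E G i
      have h1 := congrArg (fun f : ULift.{u + 1} (admissible E ρ (La.power K E G ι)) => f.down.1 x)
        (φ.2.1 s (La.coord K E G))
      have h2 := congrArg (fun f : ULift.{u + 1} (admissible E ρ (La.power K E G ι)) => f.down.1 x)
        (φ.2.2 (La.power K E G ι) (yG.const _ g) (La.coord K E G))
      exact h1.trans h2⟩
  invFun f := ⟨fun X x => ULift.up ⟨fun p => f.1 fun i => yG.fn (x i) p,
      f.2.1.comp (contMDiff_pi_manifold.2 fun i => (yG.fn (x i)).contMDiff), by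
        -- Equivariance rewrites `ρ(g) f(x)` as `f(gx)`, which is analytic in `(g, x)` because
        -- multiplication in `G` is; so admissibility is automatic.
        simp_rw [← f.2.2]
        exact f.2.1.comp (contMDiff_pi_manifold.2 fun i =>
          contMDiff_fst.mul ((yG.fn (x i)).contMDiff.comp contMDiff_snd))⟩,
    fun _ _ _ _ => rfl, fun X g x => by
      apply ULift.down_injective
      apply Subtype.ext
      funext p
      exact f.2.2 (yG.fn g p) _⟩
  left_inv φ := by
    apply Subtype.ext
    funext X x
    apply ULift.down_injective
    apply Subtype.ext
    funext p
    -- The Yoneda argument: every tuple over `X` is the pullback of the coordinate tuple along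
    -- `La.powerLift x`.
    exact congrArg (fun f : ULift.{u + 1} (admissible E ρ X) => f.down.1 p)
      (φ.2.1 (La.powerLift x) (La.coord K E G))
  right_inv f := rfl
  map_add' _ _ := rfl

theorem homogeneousCochainsEquiv_d (ρ : G →* (V ≃L[K] V)) (p : ℕ)
    (φ : (admissibleSheaf E ρ).homogeneousCochains (Fin (p + 1))) :
    homogeneousCochainsEquiv ρ (Fin (p + 2)) (EquivariantSheaf.ofCochain
        (((EquivariantSheaf.homogeneousComplex (La.topology K) (yG K E G)).obj
          (admissibleSheaf E ρ)).d p (p + 1) (EquivariantSheaf.toCochain φ))) =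
      (cochainComplex E ρ).d p (p + 1) (homogeneousCochainsEquiv ρ (Fin (p + 1)) φ) := by
  apply Subtype.ext
  funext x
  refine Eq.trans ?_ (cochainComplex_d_apply ρ p (homogeneousCochainsEquiv ρ _ φ) x).symm
  let ev : (admissibleSheaf E ρ).sheaf.obj.obj (op (La.power K E G (Fin (p + 2)))) →+ V :=
    { toFun f := (show ULift.{u + 1} (admissible E ρ (La.power K E G (Fin (p + 2)))) from
        f).down.1 x
      map_zero' := rfl
      map_add' _ _ := rfl }
  refine (congrArg ev (EquivariantSheaf.homogeneousComplex_d_apply (admissibleSheaf E ρ) p φ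
    (La.power K E G (Fin (p + 2))) (La.coord K E G))).trans ?_
  rw [map_sum]
  refine Finset.sum_congr rfl fun j _ => (map_zsmul ev _ _).trans ?_
  -- The coordinates other than the `j`-th are pulled back from the universal tuple along the `j`-th
  -- face projection of powers of `G`, so naturality of `φ` identifies the summands.
  exact congrArg (((-1 : ℤ) ^ (j : ℕ)) • ev ·)
    (φ.2.1 (La.powerLift fun i => La.coord K E G (j.succAbove i)) (La.coord K E G)).symm

end Comparison

end LocAnCoh

theorem mainTheorem5 {K : Type u} [NontriviallyNormedField K] [CompleteSpace K]
    [IsUltrametricDist K] [CharZero K]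
    {E : Type u} [NormedAddCommGroup E] [NormedSpace K E] [FiniteDimensional K E]
    {G : Type u} [TopologicalSpace G] [T2Space G] [ChartedSpace E G] [Group G]
    [LieGroup 𝓘(K, E) ω G]
    {V : Type u} [AddCommGroup V] [Module K V] [TopologicalSpace V] [IsTopologicalAddGroup V]
    [ContinuousSMul K V] [T2Space V] [IsLinearTopology (NormedField.valuation (K := K)).integer V]
    (ρ : G →* (V ≃L[K] V)) (hρ : LocAnCoh.IsLocallyAnalyticRep E ρ) (i : ℕ) :
    ∃ e : LocAnCoh.Han E ρ i ≃+ (LocAnCoh.cochainComplex E ρ).homology i,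
      ∀ (c : K) (x : LocAnCoh.Han E ρ i), e (LocAnCoh.HanSMul E ρ i c x) = c • e x := by
  obtain ⟨e, he⟩ := LocAnCoh.EquivariantSheaf.exists_cohomology_iso
    (J := LocAnCoh.La.topology K) (𝒢 := LocAnCoh.yG K E G)
    LocAnCoh.La.homogeneousCochainsMap_surjective i
  obtain ⟨e', he'⟩ := LocAnCoh.exists_homology_addEquiv.{u + 1, u} (LocAnCoh.cochainComplex E ρ)
    ((LocAnCoh.EquivariantSheaf.homogeneousComplex (LocAnCoh.La.topology K)
      (LocAnCoh.yG K E G)).obj (LocAnCoh.admissibleSheaf E ρ))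
    (fun p => LocAnCoh.homogeneousCochainsEquiv ρ (Fin (p + 1)))
    (LocAnCoh.homogeneousCochainsEquiv_d ρ) i
  refine ⟨(e (LocAnCoh.admissibleSheaf E ρ)).addCommGroupIsoToAddEquiv.trans e', fun c x => ?_⟩
  -- Multiplication by `c` on `V̲` passes by naturality to the cohomology of homogeneous cochains,
  -- where it is induced by pointwise multiplication by `c`.
  have h := ConcreteCategory.congr_hom (he (LocAnCoh.admissibleSheafSMul E ρ c)) x
  exact (congrArg e' h).trans (he' c _ (fun p φ => rfl) _)
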